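/- Let $\Bbbk$ be an algebraically closed field (of any characteristic), let $G$ be an affine algebraic group over $\Bbbk$, not necessarily connected, and let $H\subseteq G$ be a Zariski-closed subgroup. Write $\Bbbk[G]$ for the algebra of polynomial functions on $G$, and $\Bbbk[H]$ for the algebra of their restrictions to $H$. A rational $G$-module is a $\Bbbk$-vector space $V$, not necessarily finite-dimensional, with a linear action of $G$ that comes from a $\Bbbk[G]$-comodule structure, that is, for every $v\in V$ there are finitely many $v_i\in V$ and $f_i\in\Bbbk[G]$ with $x\cdot v=\sum_i f_i(x)\,v_i$ for all $x\in G$; rational $H$-modules are defined in the same way with $\Bbbk[H]$. The subgroup $H$ is called observable in $G$ if for every finite-dimensional rational $H$-module $M$ there are a rational $G$-module $N$ and an injective $H$-equivariant linear map $M\to N$. The homogeneous space $G/H$ is the set of left cosets $xH$ with the quotient topology of the Zariski topology of $G$ under the projection $\pi\colon G\to G/H$ and with the structure sheaf whose sections on an open set $U\subseteq G/H$ are the functions $f\colon U\to\Bbbk$ such that $f\circ\pi$ is regular on $\pi^{-1}(U)$. It is called quasi-affine if it is isomorphic, as a space with a sheaf of $\Bbbk$-valued functions, to an open subset of an affine variety.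 Then $H$ is observable in $G$ if and only if the homogeneous space $G/H$ is quasi-affine. -/

import Mathlib

open TopologicalSpace

universe u v w

noncomputable section

/-! ### Affine varieties, given by a point set and its algebra of polynomial functions -/

/-- The pair `(X, A)` is an affine variety over `k` with algebra of polynomial functions `A`:
`A` is a finitely generated algebra of `k`-valued functions on `X`, it separates the points of `X`,
and every `k`-algebra homomorphism `A → k` is the evaluation at a point of `X`. -/
structure IsAffineVariety {k : Type u} [Field k] {X : Type v} (A : Subalgebra k (X → k)) :
    Prop where
  fg : A.FG
  eval_bijective :
    Function.Bijective fun x : X => ((Pi.evalAlgHom k (fun _ : X => k) x).comp A.val : A →ₐ[k] k)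

/-- The Zariski topology on `X`: the sets `{x | f x ≠ 0}`, `f ∈ A`, are a basis of it. -/
@[reducible]
def zariskiTopology {k : Type u} [Field k] {X : Type v} (A : Subalgebra k (X → k)) :
    TopologicalSpace X :=
  generateFrom {U | ∃ f ∈ A, U = {x | f x ≠ 0}}

/-- A group `G` with an algebra `A` of `k`-valued functions is an affine algebraic group: `(G, A)` is
an affine variety, and the multiplication and the inversion are morphisms of varieties, that is,
for `f ∈ A` the function `(x, y) ↦ f (x * y)` lies in `A ⊗ A` and `x ↦ f x⁻¹` lies in `A`. -/
structure IsAffineAlgebraicGroup {k : Type u} [Field k] {G : Type v} [Group G]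
    (A : Subalgebra k (G → k)) : Prop extends IsAffineVariety A where
  mul_mem' : ∀ f ∈ A, ∃ (n : ℕ) (f₁ f₂ : Fin n → G → k), (∀ i, f₁ i ∈ A) ∧ (∀ i, f₂ i ∈ A) ∧
    ∀ x y : G, f (x * y) = ∑ i, f₁ i x * f₂ i y
  inv_mem' : ∀ f ∈ A, (fun x => f x⁻¹) ∈ A

/-- The restrictions to `S` of the functions in `A`; this is the algebra of polynomial functions
of `S` if `S` is closed. -/
def restrictFunctions {k : Type u} [Field k] {X : Type v} (A : Subalgebra k (X → k)) (S : Set X) :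
    Subalgebra k (S → k) :=
  A.map (AlgHom.pi fun s => Pi.evalAlgHom k (fun _ : X => k) s.1)

/-! ### Rational modules and observable subgroups -/

/-- A linear representation of `G` on `V` (of any dimension) is rational if it comes from an
`A`-comodule structure `V → V ⊗ A`: for every `v` there are finitely many `vᵢ ∈ V`, `fᵢ ∈ A` with
`x • v = ∑ fᵢ(x) vᵢ` for all `x ∈ G`. -/
def IsRationalRepresentation {k : Type u} [Field k] {G : Type v} [Group G]
    (A : Subalgebra k (G → k)) {V : Type w} [AddCommGroup V] [Module k V]
    (ρ : Representation k G V) : Prop :=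
  ∀ v : V, ∃ (n : ℕ) (f : Fin n → G → k) (b : Fin n → V), (∀ i, f i ∈ A) ∧
    ∀ x : G, ρ x v = ∑ i, f i x • b i

/-- `H` is observable in `G`: every finite-dimensional rational `H`-module is isomorphic to an
`H`-submodule of a rational `G`-module. (Finite-dimensional spaces, and the `G`-submodules of
rational modules that they generate, have copies in the universe of `k`.) -/
def IsObservable {k : Type u} [Field k] {G : Type v} [Group G]
    (A : Subalgebra k (G → k)) (H : Subgroup G) : Prop :=
  ∀ (M : Type u) [AddCommGroup M] [Module k M] [FiniteDimensional k M]
    (σ : Representation k H M),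
    IsRationalRepresentation (restrictFunctions A (H : Set G)) σ →
    ∃ (N : Type u) (_ : AddCommGroup N) (_ : Module k N) (ρ : Representation k G N),
      IsRationalRepresentation A ρ ∧
      ∃ ι : M →ₗ[k] N, Function.Injective ι ∧ ∀ (h : H) (m : M), ι (σ h m) = ρ (h : G) (ι m)

/-! ### Spaces with functions -/

/-- A topological space with a sheaf of `k`-algebras of `k`-valued functions (the regular
functions). -/
structure SpaceWithFunctions (k : Type u) [Field k] where
  carrier : Type v
  [top : TopologicalSpace carrier]
  /-- The algebra of regular functions on an open set. -/
  regular (U : Opens carrier) : Subalgebra k (U → k)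
  restrict : ∀ {U V : Opens carrier} (h : V ≤ U) (f : U → k), f ∈ regular U →
    (fun y : V => f ⟨y.1, h y.2⟩) ∈ regular V
  glue : ∀ {U : Opens carrier} (f : U → k),
    (∀ x : U, ∃ (V : Opens carrier) (h : V ≤ U), x.1 ∈ V ∧
      (fun y : V => f ⟨y.1, h y.2⟩) ∈ regular V) → f ∈ regular U

attribute [instance] SpaceWithFunctions.top

namespace SpaceWithFunctions

/-- `φ` is an isomorphism of `X` onto an open subset of `Y`: it is a homeomorphism onto an open
subset, and for every open `V` inside the image of `φ` a function `f` on `V` is regular if and only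
if `f ∘ φ` is regular on the preimage of `V`. -/
def IsOpenImmersion {k : Type u} [Field k] (X : SpaceWithFunctions.{u, v} k)
    (Y : SpaceWithFunctions.{u, w} k) (φ : C(X.carrier, Y.carrier)) : Prop :=
  Topology.IsOpenEmbedding φ ∧
    ∀ V : Opens Y.carrier, (V : Set Y.carrier) ⊆ Set.range φ → ∀ f : V → k,
      f ∈ Y.regular V ↔
        (fun x : Opens.comap φ V => f ⟨φ x.1, x.2⟩) ∈ X.regular (Opens.comap φ V)

/-- An affine variety as a space with functions: it has the Zariski topology, and a function on an
open set is regular if locally it is a quotient `g / h` with `g, h ∈ A` and `h` without zeros. -/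
def ofAffine {k : Type u} [Field k] {X : Type v} (A : Subalgebra k (X → k)) :
    SpaceWithFunctions.{u, v} k :=
  letI : TopologicalSpace X := zariskiTopology A
  { carrier := X
    regular := fun U =>
      { carrier := {f | ∀ x : U, ∃ V : Opens X, x.1 ∈ V ∧ ∃ g ∈ A, ∃ h ∈ A,
          ∀ y : U, y.1 ∈ V → h y.1 ≠ 0 ∧ f y = g y.1 / h y.1}
        mul_mem' := by
          intro a b ha hb x
          obtain ⟨V, hxV, g, hg, h, hh, H⟩ := ha x
          obtain ⟨V', hxV', g', hg', h', hh', H'⟩ := hb x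
          refine ⟨V ⊓ V', ⟨hxV, hxV'⟩, g * g', A.mul_mem hg hg', h * h', A.mul_mem hh hh',
            fun y hy => ?_⟩
          obtain ⟨h1, h2⟩ := H y hy.1
          obtain ⟨h1', h2'⟩ := H' y hy.2
          exact ⟨mul_ne_zero h1 h1', by simp [h2, h2', div_mul_div_comm]⟩
        add_mem' := by
          intro a b ha hb x
          obtain ⟨V, hxV, g, hg, h, hh, H⟩ := ha x
          obtain ⟨V', hxV', g', hg', h', hh', H'⟩ := hb x
          refine ⟨V ⊓ V', ⟨hxV, hxV'⟩, g * h' + h * g',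
            A.add_mem (A.mul_mem hg hh') (A.mul_mem hh hg'), h * h', A.mul_mem hh hh',
            fun y hy => ?_⟩
          obtain ⟨h1, h2⟩ := H y hy.1
          obtain ⟨h1', h2'⟩ := H' y hy.2
          exact ⟨mul_ne_zero h1 h1', by simp [h2, h2', div_add_div _ _ h1 h1']⟩
        algebraMap_mem' := by
          intro r x
          exact ⟨⊤, trivial, algebraMap k (X → k) r, A.algebraMap_mem r, 1, A.one_mem,
            fun y _ => ⟨one_ne_zero, by simp⟩⟩ }
    restrict := by
      intro U V hVU f hf x
      obtain ⟨W, hxW, g, hg, h, hh, H⟩ := hf ⟨x.1, hVU x.2⟩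
      exact ⟨W, hxW, g, hg, h, hh, fun y hy => H ⟨y.1, hVU y.2⟩ hy⟩
    glue := by
      intro U f hf x
      obtain ⟨V, hVU, hxV, hfV⟩ := hf x
      obtain ⟨W, hxW, g, hg, h, hh, H⟩ := hfV ⟨x.1, hxV⟩
      exact ⟨V ⊓ W, ⟨hxV, hxW⟩, g, hg, h, hh, fun y hy => H ⟨y.1, hy.1⟩ hy.2⟩ }

/-- The quotient of a space with functions `X` by an equivalence relation: it has the quotient
topology, and a function on an open set `U` is regular if its pullback to the preimage of `U` in
`X` is regular. -/
def quotient {k : Type u} [Field k] (X : SpaceWithFunctions.{u, v} k) (r : Setoid X.carrier) :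
    SpaceWithFunctions.{u, v} k where
  carrier := Quotient r
  regular U := (X.regular (Opens.comap ⟨Quotient.mk r, continuous_quotient_mk'⟩ U)).comap
    (AlgHom.pi fun x => Pi.evalAlgHom k (fun _ : U => k) ⟨Quotient.mk r x.1, x.2⟩)
  restrict := by
    intro U V h f hf
    exact X.restrict (Opens.comap_mono _ h) _ hf
  glue := by
    intro U f hf
    refine X.glue _ fun x => ?_
    obtain ⟨V, hVU, hxV, hfV⟩ := hf ⟨Quotient.mk r x.1, x.2⟩
    exact ⟨Opens.comap _ V, Opens.comap_mono _ hVU, hxV, hfV⟩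

/-- A quasi-affine variety is a space with functions that is isomorphic to an open subset of an
affine variety. (Every affine variety over `k` has a copy in the universe of `k`.) -/
def IsQuasiAffine {k : Type u} [Field k] (X : SpaceWithFunctions.{u, v} k) : Prop :=
  ∃ (Y : Type u) (B : Subalgebra k (Y → k)), IsAffineVariety B ∧
    ∃ φ : C(X.carrier, (ofAffine B).carrier), IsOpenImmersion X (ofAffine B) φ

end SpaceWithFunctions

/-- The homogeneous space `G/H` of left cosets `xH`: the quotient of the variety `G` by the right
multiplications by elements of `H`. -/
def homogeneousSpace {k : Type u} [Field k] {G : Type v} [Group G]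
    (A : Subalgebra k (G → k)) (H : Subgroup G) : SpaceWithFunctions.{u, v} k :=
  (SpaceWithFunctions.ofAffine A).quotient (@QuotientGroup.leftRel G _ H)

end

/-! Both properties of `H` are equivalent to a third one, `HasEquivariantExtensions`: every matrix
representation ρ of `H` extends to a polynomial matrix function a on `G` with a(1) = 1 and a(xh) =
a(x)ρ(h). Its equivalence with observability is the dictionary between modules and matrix
coefficients.

If G/H is quasi-affine, invariant polynomials separate points from closed sets, so a semi-invariant
that is nonzero at 1 has a partner of inverse weight (`exists_inverse_semiinvariant`). Any ρ can be
recovered from the action of `H` on some V/W, where V is a right-stable space of functions on `G`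
and W is its part vanishing on `H`. A Schur complement extends this action up to the determinant of
the action on W, and the partner of that determinant removes the factor.

Conversely, an equivariant matrix turns functions spanning an `H`-module into invariants
(`exists_frame`). This yields invariants that separate points from closed sets, and invariants that
generate the ideal of `H` near `H`. A finitely generated left-stable algebra B of invariants
containing the latter satisfies f ⊗ 1 = 1 ⊗ f in A ⊗_B A for every invariant f
(`algHom_eq_of_generators`). Arguing with points in arbitrary k-algebras takes care of
inseparability, so the characteristic plays no role. Descent over the localization of B at a minimal
prime, which is a field, shows that f is generically a quotient of elements of B; left translation
extends this to every point. By Chevalley's theorem and translation again, the image of `G` in the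
variety of B is open, and G/H is identified with this image. -/

theorem exists_algHom_of_isMaximal {k : Type*} [Field k] [IsAlgClosed k] {R : Type*} [CommRing R]
    [Algebra k R] [Algebra.FiniteType k R] (m : Ideal R) [m.IsMaximal] :
    ∃ ψ : R →ₐ[k] k, ∀ r, r ∈ m ↔ ψ r = 0 := by
  let : Field (R ⧸ m) := Ideal.Quotient.field m
  have : Module.Finite k (R ⧸ m) := finite_of_finite_type_of_isJacobsonRing k (R ⧸ m)
  have hbij : Function.Bijective (algebraMap k (R ⧸ m)) :=
    IsAlgClosed.algebraMap_bijective_of_isIntegral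
  let e : k ≃ₐ[k] (R ⧸ m) := AlgEquiv.ofBijective (Algebra.ofId k (R ⧸ m)) hbij
  refine ⟨e.symm.toAlgHom.comp (Ideal.Quotient.mkₐ k m), fun r => ?_⟩
  rw [← Ideal.Quotient.eq_zero_iff_mem]
  simp

/-! ### Affine varieties: Nullstellensatz and functions on principal open sets -/

section AffineVariety

variable {k : Type u} [Field k] {X : Type v} {A : Subalgebra k (X → k)}

/-- Over an algebraically closed field the maximal ideals of the coordinate ring are the points. -/
theorem IsAffineVariety.exists_forall_mem_iff [IsAlgClosed k] (hA : IsAffineVariety A)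
    (m : Ideal A) [hm : m.IsMaximal] : ∃ x : X, ∀ f : A, f ∈ m ↔ f.1 x = 0 := by
  have : Algebra.FiniteType k A := A.fg_iff_finiteType.mp hA.fg
  obtain ⟨ψ, hψ⟩ := exists_algHom_of_isMaximal (k := k) m
  obtain ⟨x, hx⟩ := hA.eval_bijective.2 ψ
  refine ⟨x, fun f => ?_⟩
  have h1 : f.1 x = ψ f := DFunLike.congr_fun hx f
  rw [h1, hψ]

/-- Hilbert's Nullstellensatz: a finitely generated algebra is a Jacobson ring, so the radical of
`J` is the intersection of the maximal ideals above it, and these are points. -/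
theorem IsAffineVariety.exists_pow_mem [IsAlgClosed k] (hA : IsAffineVariety A)
    (J : Ideal A) (b : A) (h : ∀ x, (∀ f ∈ J, f.1 x = 0) → b.1 x = 0) : ∃ n : ℕ, b ^ n ∈ J := by
  have : Algebra.FiniteType k A := A.fg_iff_finiteType.mp hA.fg
  have : IsJacobsonRing A := isJacobsonRing_of_finiteType (A := k)
  have hb : b ∈ J.jacobson := by
    rw [Ideal.jacobson, Ideal.mem_sInf]
    rintro m ⟨hJm, hm⟩
    obtain ⟨x, hx⟩ := hA.exists_forall_mem_iff m
    exact (hx b).2 (h x fun f hf => (hx f).1 (hJm hf))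
  rw [← Ideal.radical_eq_jacobson] at hb
  exact hb

/-- Principal open sets are stable under finite intersections, since f g ≠ 0 means f ≠ 0 and g ≠ 0;
so the generating family is a basis. -/
theorem isOpen_zariskiTopology_iff {U : Set X} :
    @IsOpen X (zariskiTopology A) U ↔ ∀ x ∈ U, ∃ f ∈ A, f x ≠ 0 ∧ ∀ y, f y ≠ 0 → y ∈ U := by
  constructor
  · intro hU
    induction hU with
    | basic s hs =>
      obtain ⟨f, hf, rfl⟩ := hs
      exact fun x hx => ⟨f, hf, hx, fun y hy => hy⟩
    | univ => exact fun x _ => ⟨1, A.one_mem, one_ne_zero, fun _ _ => trivial⟩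
    | inter s t _ _ hs ht =>
      rintro x ⟨hxs, hxt⟩
      obtain ⟨f, hf, hfx, hfs⟩ := hs x hxs
      obtain ⟨g, hg, hgx, hgt⟩ := ht x hxt
      refine ⟨f * g, A.mul_mem hf hg, mul_ne_zero hfx hgx, fun y hy => ?_⟩
      exact ⟨hfs y (left_ne_zero_of_mul hy), hgt y (right_ne_zero_of_mul hy)⟩
    | sUnion S _ ih =>
      rintro x ⟨s, hs, hxs⟩
      obtain ⟨f, hf, hfx, hfs⟩ := ih s hs x hxs
      exact ⟨f, hf, hfx, fun y hy => ⟨s, hs, hfs y hy⟩⟩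
  · intro h
    let := zariskiTopology A
    rw [isOpen_iff_forall_mem_open]
    intro x hx
    obtain ⟨f, hf, hfx, hfU⟩ := h x hx
    exact ⟨{y | f y ≠ 0}, hfU, isOpen_generateFrom_of_mem ⟨f, hf, rfl⟩, hfx⟩

theorem isOpen_zariskiTopology_ne_zero {f : X → k} (hf : f ∈ A) :
    @IsOpen X (zariskiTopology A) {x | f x ≠ 0} :=
  isOpen_generateFrom_of_mem ⟨f, hf, rfl⟩

theorem mem_regular_ofAffine_iff (U : Opens (SpaceWithFunctions.ofAffine A).carrier) (f : U → k) :
    f ∈ (SpaceWithFunctions.ofAffine A).regular U ↔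
      ∀ x : U, ∃ s ∈ A, s x.1 ≠ 0 ∧ ∃ g ∈ A, ∃ d ∈ A,
        ∀ y : U, s y.1 ≠ 0 → d y.1 ≠ 0 ∧ f y = g y.1 / d y.1 := by
  let := zariskiTopology A
  constructor
  · intro hf x
    obtain ⟨V, hxV, g, hg, d, hd, h⟩ := hf x
    obtain ⟨s, hs, hsx, hsV⟩ := isOpen_zariskiTopology_iff.1 V.2 x.1 hxV
    exact ⟨s, hs, hsx, g, hg, d, hd, fun y hy => h y (hsV _ hy)⟩
  · intro hf x
    obtain ⟨s, hs, hsx, g, hg, d, hd, h⟩ := hf x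
    exact ⟨⟨{y | s y ≠ 0}, isOpen_zariskiTopology_ne_zero hs⟩, hsx, g, hg, d, hd, h⟩

/-- A function on `U` that is locally a quotient of polynomial functions is of the form `g / c ^ n`
on the principal open set of `c`, if that is contained in `U`. -/
theorem IsAffineVariety.exists_pow_mul_eq [IsAlgClosed k] (hA : IsAffineVariety A)
    (U : Set X) (f : U → k)
    (hf : ∀ x : U, ∃ s ∈ A, s x.1 ≠ 0 ∧ ∃ g ∈ A, ∃ d ∈ A,
        ∀ y : U, s y.1 ≠ 0 → d y.1 ≠ 0 ∧ f y = g y.1 / d y.1)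
    (c : X → k) (hc : c ∈ A) (hcU : ∀ x : X, c x ≠ 0 → x ∈ U) :
    ∃ (n : ℕ) (g : X → k), g ∈ A ∧ ∀ (x : X) (hx : c x ≠ 0), c x ^ n * f ⟨x, hcU x hx⟩ = g x := by
  -- The ideal of denominators of `f` on the principal open set of `c`. It has no common zero there,
  -- so it contains a power of `c`.
  let J : Ideal A :=
    { carrier := {d | ∃ g ∈ A, ∀ (x : X) (hx : c x ≠ 0), d.1 x * f ⟨x, hcU x hx⟩ = g x}
      zero_mem' := ⟨0, A.zero_mem, fun x _ => by simp⟩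
      add_mem' := by
        rintro a b ⟨g, hg, h⟩ ⟨g', hg', h'⟩
        exact ⟨g + g', A.add_mem hg hg', fun x hx => by simp [add_mul, h x hx, h' x hx]⟩
      smul_mem' := by
        rintro a b ⟨g, hg, h⟩
        exact ⟨a.1 * g, A.mul_mem a.2 hg, fun x hx => by simp [mul_assoc, h x hx]⟩ }
  obtain ⟨n, g, hg, h⟩ := hA.exists_pow_mem J ⟨c, hc⟩ (by
    intro x hx
    by_contra hcx
    obtain ⟨s, hs, hsx, g, hg, d, hd, hV⟩ := hf ⟨x, hcU x hcx⟩
    have h1 : (⟨s * d, A.mul_mem hs hd⟩ : A) ∈ J := by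
      refine ⟨s * g, A.mul_mem hs hg, fun y hy => ?_⟩
      by_cases hsy : s y = 0
      · simp [hsy]
      · obtain ⟨h2, h3⟩ := hV ⟨y, hcU y hy⟩ hsy
        rw [h3]
        change s y * d y * (g y / d y) = s y * g y
        field_simp
    exact mul_ne_zero hsx (hV ⟨x, hcU x hcx⟩ hsx).1 (hx _ h1))
  exact ⟨n, g, hg, fun x hx => by simpa using h x hx⟩

end AffineVariety

/-! ### Translations of polynomial functions and local finiteness -/

section Translation

variable {k : Type u} [Field k] {G : Type v} [Group G] {A : Subalgebra k (G → k)}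

theorem IsAffineAlgebraicGroup.mul_right_mem (hA : IsAffineAlgebraicGroup A) {f : G → k}
    (hf : f ∈ A) (g : G) : (fun x => f (x * g)) ∈ A := by
  obtain ⟨n, f₁, f₂, h₁, -, h⟩ := hA.mul_mem' f hf
  have : (fun x => f (x * g)) = ∑ i, f₂ i g • f₁ i := by
    ext x; simp [h, mul_comm]
  rw [this]
  exact A.sum_mem fun i _ => A.smul_mem (h₁ i) _

theorem IsAffineAlgebraicGroup.mul_left_mem (hA : IsAffineAlgebraicGroup A) {f : G → k}
    (hf : f ∈ A) (g : G) : (fun x => f (g * x)) ∈ A := by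
  obtain ⟨n, f₁, f₂, -, h₂, h⟩ := hA.mul_mem' f hf
  have : (fun x => f (g * x)) = ∑ i, f₁ i g • f₂ i := by
    ext x; simp [h]
  rw [this]
  exact A.sum_mem fun i _ => A.smul_mem (h₂ i) _

/-- The span of all translates of `S` works. An abstract family `T` closed under composition covers
left and right translations at once, although they compose in opposite orders. -/
theorem exists_finiteDimensional_of_translates {ι X : Type*} (T : ι → X → X)
    (hid : ∃ i, T i = id) (hcomp : ∀ i j, ∃ l, T i ∘ T j = T l) (S : Set (X → k)) (hS : S.Finite)
    (hfin : ∀ f ∈ S, ∃ U : Submodule k (X → k), FiniteDimensional k U ∧ ∀ i, f ∘ T i ∈ U)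
    (P : Submodule k (X → k)) (hP : ∀ f ∈ S, ∀ i, f ∘ T i ∈ P) :
    ∃ V : Submodule k (X → k), FiniteDimensional k V ∧ V ≤ P ∧ S ⊆ V ∧
      ∀ f ∈ V, ∀ i, f ∘ T i ∈ V := by
  classical
  choose! U hU hfU using hfin
  let V : Submodule k (X → k) := Submodule.span k {φ | ∃ f ∈ S, ∃ i, φ = f ∘ T i}
  refine ⟨V, ?_, ?_, ?_, ?_⟩
  · have := hS.to_subtype
    have : ∀ f : S, FiniteDimensional k (U f.1) := fun f => hU f.1 f.2
    have hle : V ≤ ⨆ f : S, U f.1 := by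
      refine Submodule.span_le.2 ?_
      rintro _ ⟨f, hf, i, rfl⟩
      exact Submodule.mem_iSup_of_mem (⟨f, hf⟩ : S) (hfU f hf i)
    exact Submodule.finiteDimensional_of_le hle
  · refine Submodule.span_le.2 ?_
    rintro _ ⟨f, hf, i, rfl⟩
    exact hP f hf i
  · intro f hf
    obtain ⟨i, hi⟩ := hid
    exact Submodule.subset_span ⟨f, hf, i, by rw [hi]; rfl⟩
  · intro f hf i
    have : V ≤ V.comap (LinearMap.funLeft k k (T i)) := by
      refine Submodule.span_le.2 ?_
      rintro _ ⟨f, hf, j, rfl⟩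
      obtain ⟨l, hl⟩ := hcomp j i
      exact Submodule.subset_span ⟨f, hf, l, by rw [← hl]; rfl⟩
    exact this hf

theorem IsAffineAlgebraicGroup.exists_right_stable (hA : IsAffineAlgebraicGroup A)
    (S : Set (G → k)) (hS : S.Finite) (hSA : S ⊆ A) :
    ∃ V : Submodule k (G → k), FiniteDimensional k V ∧ V ≤ Subalgebra.toSubmodule A ∧ S ⊆ V ∧
      ∀ f ∈ V, ∀ g : G, (fun x => f (x * g)) ∈ V := by
  refine exists_finiteDimensional_of_translates (fun g x => x * g) ⟨1, by ext; simp⟩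
    (fun g g' => ⟨g' * g, by ext; simp [mul_assoc]⟩) S hS (fun f hf => ?_) _
    (fun f hf g => hA.mul_right_mem (hSA hf) g)
  obtain ⟨n, f₁, f₂, -, -, h⟩ := hA.mul_mem' f (hSA hf)
  refine ⟨Submodule.span k (Set.range f₁), .span_of_finite k (Set.finite_range f₁), fun g => ?_⟩
  have : (f ∘ fun x => x * g) = ∑ i, f₂ i g • f₁ i := by ext x; simp [h, mul_comm]
  rw [this]
  exact Submodule.sum_mem _ fun i _ => Submodule.smul_mem _ _ (Submodule.subset_span ⟨i, rfl⟩)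

theorem IsAffineAlgebraicGroup.exists_left_stable (hA : IsAffineAlgebraicGroup A)
    (S : Set (G → k)) (hS : S.Finite) (P : Submodule k (G → k))
    (hPA : P ≤ Subalgebra.toSubmodule A) (hP : ∀ f ∈ P, ∀ g : G, (fun x => f (g * x)) ∈ P)
    (hSP : S ⊆ P) :
    ∃ V : Submodule k (G → k), FiniteDimensional k V ∧ V ≤ P ∧ S ⊆ V ∧
      ∀ f ∈ V, ∀ g : G, (fun x => f (g * x)) ∈ V := by
  refine exists_finiteDimensional_of_translates (fun g x => g * x) ⟨1, by ext; simp⟩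
    (fun g g' => ⟨g * g', by ext; simp [mul_assoc]⟩) S hS (fun f hf => ?_) P
    (fun f hf g => hP f (hSP hf) g)
  obtain ⟨n, f₁, f₂, -, -, h⟩ := hA.mul_mem' f (hPA (hSP hf))
  refine ⟨Submodule.span k (Set.range f₂), .span_of_finite k (Set.finite_range f₂), fun g => ?_⟩
  have : (f ∘ fun x => g * x) = ∑ i, f₁ i g • f₂ i := by ext x; simp [h]
  rw [this]
  exact Submodule.sum_mem _ fun i _ => Submodule.smul_mem _ _ (Submodule.subset_span ⟨i, rfl⟩)

end Translation

/-! ### Observability in terms of matrix coefficients -/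

section MatrixCriterion

variable {k : Type u} [Field k] {G : Type v} [Group G] {A : Subalgebra k (G → k)} {H : Subgroup G}

theorem mem_restrictFunctions_iff {X : Type*} {A : Subalgebra k (X → k)} {S : Set X} {f : S → k} :
    f ∈ restrictFunctions A S ↔ ∃ F ∈ A, ∀ s : S, f s = F s := by
  constructor
  · rintro ⟨F, hF, rfl⟩
    exact ⟨F, hF, fun s => rfl⟩
  · rintro ⟨F, hF, h⟩
    exact ⟨F, hF, funext fun s => (h s).symm⟩

/-- Every matrix representation of `H` with coefficients in `k[H]` is the restriction to `H` of an
`H`-equivariant matrix of polynomial functions on `G`. -/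
def HasEquivariantExtensions (A : Subalgebra k (G → k)) (H : Subgroup G) : Prop :=
  ∀ (n : ℕ) (ρ : H →* Matrix (Fin n) (Fin n) k),
    (∀ i j, (fun h => ρ h i j) ∈ restrictFunctions A (H : Set G)) →
    ∃ a : G → Matrix (Fin n) (Fin n) k, (∀ i j, (fun x => a x i j) ∈ A) ∧ a 1 = 1 ∧
      ∀ (x : G) (h : H), a (x * h) = a x * ρ h

/-- Embed kⁿ by ι into a rational `G`-module with action τ and choose a linear retraction r; then
a(x) = r τ(x) ι. -/
theorem IsObservable.hasEquivariantExtensions (hobs : IsObservable A H) :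
    HasEquivariantExtensions A H := by
  intro n ρ hρ
  let σ : Representation k H (Fin n → k) :=
    { toFun := fun h => Matrix.toLin' (ρ h)
      map_one' := by simp; rfl
      map_mul' := fun h h' => by rw [map_mul, Matrix.toLin'_mul]; rfl }
  have hσ : ∀ h m, σ h m = (ρ h).mulVec m := fun h m => rfl
  obtain ⟨N, _, _, τ, hτ, ι, hι, hequiv⟩ := hobs (Fin n → k) σ (by
    intro m
    refine ⟨n, fun i h => ∑ j, ρ h i j * m j, fun i => Pi.single i 1, fun i => ?_, fun h => ?_⟩
    · have : (fun h => ∑ j, ρ h i j * m j) = ∑ j, m j • (fun h => ρ h i j) := by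
        ext h; simp [mul_comm]
      change (fun h => ∑ j, ρ h i j * m j) ∈ _
      rw [this]
      exact Subalgebra.sum_mem _ fun j _ => Subalgebra.smul_mem _ (hρ i j) _
    · ext l
      simp [hσ, Matrix.mulVec, dotProduct, Pi.single_apply])
  obtain ⟨r, hr⟩ := LinearMap.exists_leftInverse_of_injective ι (LinearMap.ker_eq_bot.2 hι)
  have hr' : ∀ m, r (ι m) = m := fun m => LinearMap.congr_fun hr m
  refine ⟨fun x => Matrix.of fun i j => r (τ x (ι (Pi.single j 1))) i, fun i j => ?_, ?_, ?_⟩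
  · obtain ⟨l, f, b, hf, h⟩ := hτ (ι (Pi.single j 1))
    have : (fun x => Matrix.of (fun i j => r (τ x (ι (Pi.single j 1))) i) i j) =
        ∑ s, r (b s) i • f s := by
      ext x; simp [h, mul_comm]
    rw [this]
    exact A.sum_mem fun s _ => A.smul_mem (hf s) _
  · ext i j
    simp [hr', Matrix.one_apply, Pi.single_apply]
  · intro x h
    ext i j
    have h1 : σ h (Pi.single j 1) = ∑ l, ρ h l j • (Pi.single l 1 : Fin n → k) := by
      ext l
      simp [hσ, Pi.single_apply]
    have h2 : τ (x * h) (ι (Pi.single j 1)) = ∑ l, ρ h l j • τ x (ι (Pi.single l 1)) := by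
      rw [map_mul, Module.End.mul_apply, ← hequiv, h1]
      simp
    change r (τ (x * h) (ι (Pi.single j 1))) i = _
    rw [h2]
    simp [Matrix.mul_apply, mul_comm]

theorem isRationalRepresentation_of_fintype {V : Type*} [AddCommGroup V] [Module k V]
    {ρ : Representation k G V}
    (h : ∀ v : V, ∃ (ι : Type) (_ : Fintype ι) (f : ι → G → k) (b : ι → V), (∀ i, f i ∈ A) ∧
      ∀ x : G, ρ x v = ∑ i, f i x • b i) : IsRationalRepresentation A ρ := by
  intro v
  obtain ⟨ι, _, f, b, hf, h⟩ := h v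
  let e := (Fintype.equivFin ι).symm
  exact ⟨Fintype.card ι, f ∘ e, b ∘ e, fun i => hf _, fun x => by
    rw [h x, ← e.sum_comp]; rfl⟩

/-- The vector m is sent to the function x ↦ a(x)m in Aⁿ, on which `G` acts by right translation;
evaluation at 1 shows injectivity. -/
theorem HasEquivariantExtensions.isObservable (hA : IsAffineAlgebraicGroup A)
    (hext : HasEquivariantExtensions A H) : IsObservable A H := by
  intro M _ _ _ σ hσ
  -- Observability asks for a module in the universe of `k`; `A` has a copy there as a quotient of a
  -- polynomial ring.
  have : Small.{u} A := by
    have : Algebra.FiniteType k A := A.fg_iff_finiteType.mp hA.fg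
    obtain ⟨n, f, hf⟩ := Algebra.FiniteType.iff_quotient_mvPolynomial''.1 this
    exact small_of_surjective hf
  obtain ⟨n, ⟨b⟩⟩ : ∃ n, Nonempty (Module.Basis (Fin n) k M) := ⟨_, ⟨Module.finBasis k M⟩⟩
  let ρ : H →* Matrix (Fin n) (Fin n) k :=
    (LinearMap.toMatrixAlgEquiv b : (M →ₗ[k] M) →* Matrix (Fin n) (Fin n) k).comp σ
  have hρ : ∀ h i j, ρ h i j = b.repr (σ h (b j)) i := fun h i j =>
    LinearMap.toMatrixAlgEquiv_apply b _ i j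
  obtain ⟨a, ha, ha1, hmul⟩ := hext n ρ (by
    intro i j
    obtain ⟨l, f, v, hf, h⟩ := hσ (b j)
    have : (fun h => ρ h i j) = ∑ s, b.repr (v s) i • f s := by
      ext x; simp [hρ, h, mul_comm]
    rw [this]
    exact Subalgebra.sum_mem _ fun s _ => Subalgebra.smul_mem _ (hf s) _)
  let T : G → (Fin n → A) →ₗ[k] (Fin n → A) := fun g =>
    { toFun := fun F i => ⟨fun x => (F i).1 (x * g), hA.mul_right_mem (F i).2 g⟩
      map_add' := fun _ _ => rfl
      map_smul' := fun _ _ => rfl }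
  let e : (Fin n → Shrink.{u} A) ≃ₗ[k] (Fin n → A) :=
    LinearEquiv.piCongrRight fun _ => Shrink.linearEquiv k A
  let τ : Representation k G (Fin n → Shrink.{u} A) :=
    { toFun := fun g => (e.symm.toLinearMap ∘ₗ T g) ∘ₗ e.toLinearMap
      map_one' := by
        refine LinearMap.ext fun F => ?_
        have : T 1 = LinearMap.id := LinearMap.ext fun F => by ext i x; simp [T]
        simp [this]
      map_mul' := fun g g' => by
        refine LinearMap.ext fun F => ?_
        have : T (g * g') = T g ∘ₗ T g' := LinearMap.ext fun F => by ext i x; simp [T, mul_assoc]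
        simp [this] }
  have hτ : ∀ g F, τ g F = e.symm (T g (e F)) := fun _ _ => rfl
  let ι₀ : M →ₗ[k] (Fin n → A) :=
    { toFun := fun m i => ⟨fun x => ∑ j, a x i j * b.repr m j, by
        have : (fun x => ∑ j, a x i j * b.repr m j) = ∑ j, b.repr m j • fun x => a x i j := by
          ext x; simp [mul_comm]
        rw [this]
        exact A.sum_mem fun j _ => A.smul_mem (ha i j) _⟩
      map_add' := fun m m' => by
        ext i x; simp [mul_add, Finset.sum_add_distrib]
      map_smul' := fun c m => by
        ext i x; simp [Finset.mul_sum, mul_left_comm] }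
  have hι₀ : ∀ m i x, (ι₀ m i).1 x = ∑ j, a x i j * b.repr m j := fun _ _ _ => rfl
  refine ⟨Fin n → Shrink.{u} A, inferInstance, inferInstance, τ, ?_, e.symm.toLinearMap ∘ₗ ι₀,
    ?_, ?_⟩
  · refine isRationalRepresentation_of_fintype fun F => ?_
    choose l f₁ f₂ h₁ h₂ h using fun i => hA.mul_mem' (e F i).1 (e F i).2
    refine ⟨Σ i, Fin (l i), inferInstance, fun s => f₂ s.1 s.2,
      fun s => e.symm (Pi.single s.1 ⟨f₁ s.1 s.2, h₁ _ _⟩), fun s => h₂ _ _, fun g => ?_⟩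
    rw [hτ]
    simp only [← map_smul, ← map_sum]
    congr 1
    ext i x
    change (e F i).1 (x * g) = _
    rw [h, Fintype.sum_sigma, Finset.sum_apply, Finset.sum_eq_single i]
    · simp [mul_comm]
    · intro j _ hj
      simp [hj.symm]
    · simp
  · rw [LinearMap.coe_comp]
    refine e.symm.injective.comp ?_
    intro m m' h
    refine b.repr.injective (Finsupp.ext fun i => ?_)
    have := congrFun (congrArg Subtype.val (congrFun h i)) 1
    rw [hι₀, hι₀, ha1] at this
    simpa [Matrix.one_apply] using this
  · intro h m
    rw [hτ]
    simp only [LinearMap.comp_apply, LinearEquiv.coe_coe, LinearEquiv.apply_symm_apply]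
    congr 1
    ext i x
    change (ι₀ (σ h m) i).1 x = (ι₀ m i).1 (x * h)
    have h1 : ∀ j, b.repr (σ h m) j = ∑ l, ρ h j l * b.repr m l := by
      intro j
      conv_lhs => rw [← b.sum_repr m]
      simp only [map_sum, map_smul, Finsupp.coe_finsetSum, Finset.sum_apply, Finsupp.smul_apply,
        smul_eq_mul, hρ, mul_comm]
    rw [hι₀, hι₀, hmul]
    simp only [h1, Matrix.mul_apply, Finset.sum_mul, Finset.mul_sum]
    rw [Finset.sum_comm]
    simp [mul_assoc]

end MatrixCriterion

/-! ### From quasi-affine quotients to equivariant extensions -/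

section QuasiAffine

variable {k : Type u} [Field k] {G : Type v} [Group G] {A : Subalgebra k (G → k)} {H : Subgroup G}

/-- On a quasi-affine homogeneous space a point can be separated from a closed set by an invariant
polynomial function. -/
theorem exists_invariant_of_isQuasiAffine [IsAlgClosed k] (hA : IsAffineAlgebraicGroup A)
    (hq : (homogeneousSpace A H).IsQuasiAffine) (U : Set G) (hU : @IsOpen G (zariskiTopology A) U)
    (hUH : ∀ (x : G) (h : H), x * h ∈ U → x ∈ U) (x₀ : G) (hx₀ : x₀ ∈ U) :
    ∃ g ∈ A, (∀ (x : G) (h : H), g (x * h) = g x) ∧ (∀ x, x ∉ U → g x = 0) ∧ g x₀ ≠ 0 := by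
  obtain ⟨Y, B, hB, φ, hφ, hreg⟩ := hq
  let π : G → (homogeneousSpace A H).carrier := fun x => Quotient.mk (QuotientGroup.leftRel H) x
  have hπ : ∀ x y, π x = π y ↔ x⁻¹ * y ∈ H := fun x y =>
    Quotient.eq.trans QuotientGroup.leftRel_apply
  let O : Set (homogeneousSpace A H).carrier := {q | ∃ x ∈ U, π x = q}
  have hpre : ∀ x, π x ∈ O ↔ x ∈ U := by
    refine fun x => ⟨?_, fun hx => ⟨x, hx, rfl⟩⟩
    rintro ⟨y, hy, hyx⟩
    refine hUH x ⟨x⁻¹ * y, (hπ x y).1 hyx.symm⟩ ?_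
    simpa using hy
  have hO : IsOpen O := by
    have : π ⁻¹' O = U := Set.ext hpre
    change @IsOpen G (zariskiTopology A) (π ⁻¹' O)
    rwa [this]
  obtain ⟨b, hb, hb0, hbO⟩ := isOpen_zariskiTopology_iff.1 (hφ.isOpenMap O hO) (φ (π x₀))
    ⟨_, (hpre x₀).2 hx₀, rfl⟩
  refine ⟨fun x => b (φ (π x)), ?_, ?_, ?_, hb0⟩
  · let V : Opens (SpaceWithFunctions.ofAffine B).carrier := ⟨Set.range φ, hφ.isOpen_range⟩
    have hV := (hreg V subset_rfl (fun y => b y.1)).1 ((mem_regular_ofAffine_iff _ _).2 fun y =>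
      ⟨1, B.one_mem, one_ne_zero, b, hb, 1, B.one_mem, fun y _ => ⟨one_ne_zero, (div_one (b y.1)).symm⟩⟩)
    -- The pullback of `b` is regular on all of `G`; the denominator 1 shows that it is polynomial.
    obtain ⟨n, g, hg, h⟩ := hA.exists_pow_mul_eq _ _ ((mem_regular_ofAffine_iff _ _).1 hV) 1
      A.one_mem (fun x _ => ⟨π x, rfl⟩)
    have : (fun x => b (φ (π x))) = g := funext fun x => by
      have hx : (1 : k) ^ n * b (φ (π x)) = g x := h x one_ne_zero
      simpa using hx
    exact this ▸ hg
  · intro x h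
    have : π (x * h) = π x := (hπ _ _).2 (by simp)
    simp only [this]
  · intro x hx
    by_contra hne
    obtain ⟨q, hq, hqx⟩ := hbO _ hne
    rw [hφ.injective hqx, hpre] at hq
    exact hx hq

/-- If `f` is a semi-invariant of weight `χ`, then there is one of weight `χ⁻¹`. -/
theorem exists_inverse_semiinvariant [IsAlgClosed k] (hA : IsAffineAlgebraicGroup A)
    (hq : (homogeneousSpace A H).IsQuasiAffine) (f : G → k) (hf : f ∈ A) (hf1 : f 1 ≠ 0)
    (χ : H → k) (hfχ : ∀ (x : G) (h : H), f (x * h) = f x * χ h) :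
    ∃ f' ∈ A, f' 1 = 1 ∧ ∀ (x : G) (h : H), f' (x * h) * χ h = f' x := by
  obtain ⟨g, hg, hginv, hg0, hg1⟩ := exists_invariant_of_isQuasiAffine hA hq {x | f x ≠ 0}
    (isOpen_zariskiTopology_ne_zero hf)
    (fun x h hxh => by
      rw [Set.mem_ofPred_eq, hfχ] at hxh
      exact left_ne_zero_of_mul hxh) 1 hf1
  obtain ⟨n, hn⟩ := hA.exists_pow_mem (Ideal.span {⟨f, hf⟩}) ⟨g, hg⟩ (fun x hx => by
    have := hx _ (Ideal.mem_span_singleton_self _)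
    exact hg0 x (by simpa using this))
  obtain ⟨⟨f₁, hf₁⟩, hff₁⟩ := Ideal.mem_span_singleton'.1 hn
  have hmul : ∀ x, f₁ x * f x = g x ^ n := fun x => congrFun (congrArg Subtype.val hff₁) x
  have hf₁1 : f₁ 1 ≠ 0 := by
    intro h0
    have := hmul 1
    rw [h0, zero_mul] at this
    exact pow_ne_zero n hg1 this.symm
  -- From f₁ f = gⁿ with g invariant, f₁ has weight χ⁻¹ where f ≠ 0. The extra factor g vanishes
  -- where f does, so the relation holds everywhere.
  refine ⟨(g 1 * f₁ 1)⁻¹ • (g * f₁), A.smul_mem (A.mul_mem hg hf₁) _, ?_, fun x h => ?_⟩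
  · exact inv_mul_cancel₀ (mul_ne_zero hg1 hf₁1)
  · have key : g x * f₁ (x * h) * χ h = g x * f₁ x := by
      by_cases hfx : f x = 0
      · simp [hg0 x (by simpa using hfx)]
      · have h1 := hmul (x * h)
        rw [hginv, ← hmul x, hfχ] at h1
        have h2 : f₁ (x * h) * χ h = f₁ x := mul_right_cancel₀ hfx (by rw [← h1]; ring)
        rw [mul_assoc, h2]
    simp only [Pi.smul_apply, Pi.mul_apply, smul_eq_mul, hginv]
    rw [mul_assoc, key]

/-- For a matrix `X = (X₁₁ X₁₂; X₂₁ X₂₂)` the matrix `det X₁₁ • X₂₂ - X₂₁ adj(X₁₁) X₁₂` changes under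
right multiplication by `(P Q; 0 R)` by the factor `det P • R`. -/
theorem Matrix.schur_mul_upper {R m n : Type*} [CommRing R] [Fintype m] [DecidableEq m] [Fintype n]
    [DecidableEq n] (X₁₁ : Matrix m m R) (X₁₂ : Matrix m n R) (X₂₁ : Matrix n m R)
    (X₂₂ : Matrix n n R) (P : Matrix m m R) (Q : Matrix m n R) (T : Matrix n n R) :
    (X₁₁ * P).det • (X₂₁ * Q + X₂₂ * T) - X₂₁ * P * (X₁₁ * P).adjugate * (X₁₁ * Q + X₁₂ * T) =
      P.det • ((X₁₁.det • X₂₂ - X₂₁ * X₁₁.adjugate * X₁₂) * T) := by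
  have h1 : X₂₁ * P * (X₁₁ * P).adjugate = P.det • (X₂₁ * X₁₁.adjugate) := by
    rw [Matrix.adjugate_mul_distrib, Matrix.mul_assoc, ← Matrix.mul_assoc P, Matrix.mul_adjugate]
    simp
  have h2 : X₂₁ * X₁₁.adjugate * (X₁₁ * Q) = X₁₁.det • (X₂₁ * Q) := by
    rw [Matrix.mul_assoc, ← Matrix.mul_assoc X₁₁.adjugate, Matrix.adjugate_mul]
    simp
  rw [h1, Matrix.det_mul, Matrix.mul_add, Matrix.smul_mul, Matrix.smul_mul, h2, Matrix.sub_mul]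
  simp only [smul_sub, smul_add, smul_smul, Matrix.smul_mul, Matrix.mul_assoc]
  rw [mul_comm P.det]
  abel

theorem det_mem_and_adjugate_mem {X n : Type*} [Fintype n] [DecidableEq n]
    {A : Subalgebra k (X → k)} (M : X → Matrix n n k) (hM : ∀ i j, (fun x => M x i j) ∈ A) :
    (fun x => (M x).det) ∈ A ∧ ∀ i j, (fun x => (M x).adjugate i j) ∈ A := by
  let M' : Matrix n n A := Matrix.of fun i j => ⟨fun x => M x i j, hM i j⟩
  let ev : X → A →+* k := fun x => (Pi.evalRingHom (fun _ : X => k) x).comp A.val.toRingHom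
  have hev : ∀ x, M x = (ev x).mapMatrix M' := fun x => rfl
  constructor
  · have : (fun x => (M x).det) = M'.det.1 := funext fun x => by
      rw [hev, ← RingHom.map_det]; rfl
    exact this ▸ M'.det.2
  · intro i j
    have : (fun x => (M x).adjugate i j) = (M'.adjugate i j).1 := funext fun x => by
      rw [hev, ← RingHom.map_adjugate]; rfl
    exact this ▸ (M'.adjugate i j).2

theorem matrix_mul_mem {X l m n : Type*} [Fintype m] {A : Subalgebra k (X → k)}
    {M : X → Matrix l m k} {N : X → Matrix m n k} (hM : ∀ i j, (fun x => M x i j) ∈ A)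
    (hN : ∀ i j, (fun x => N x i j) ∈ A) (i : l) (j : n) : (fun x => (M x * N x) i j) ∈ A := by
  have : (fun x => (M x * N x) i j) = ∑ s, (fun x => M x i s) * fun x => N x s j := by
    ext x; simp [Matrix.mul_apply]
  rw [this]
  exact A.sum_mem fun s _ => A.mul_mem (hM i s) (hN s j)

theorem Submodule.exists_basis_mem_iff {V : Type*} [AddCommGroup V] [Module k V]
    [FiniteDimensional k V] (W : Submodule k V) :
    ∃ (d e : ℕ) (b : Module.Basis (Fin d ⊕ Fin e) k V),
      ∀ v, v ∈ W ↔ ∀ i, b.repr v (Sum.inr i) = 0 := by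
  obtain ⟨C, hC⟩ := W.exists_isCompl
  refine ⟨_, _, ((Module.finBasis k W).prod (Module.finBasis k C)).map
    (W.prodEquivOfIsCompl C hC), fun v => ?_⟩
  have h1 : ∀ i, (((Module.finBasis k W).prod (Module.finBasis k C)).map
      (W.prodEquivOfIsCompl C hC)).repr v (Sum.inr i) =
      (Module.finBasis k C).repr ((W.prodEquivOfIsCompl C hC).symm v).2 i := fun i => rfl
  simp only [h1]
  rw [← Submodule.prodEquivOfIsCompl_symm_apply_snd_eq_zero (h := hC)]
  constructor
  · intro h i; rw [h]; simp
  · intro h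
    exact (Module.finBasis k C).repr.map_eq_zero_iff.1 (Finsupp.ext h)

/-- The matrix coefficients of the right translations are polynomial. -/
theorem IsAffineAlgebraicGroup.right_translate_coeff_mem (hA : IsAffineAlgebraicGroup A)
    (ℓ : (G → k) →ₗ[k] k) {v : G → k} (hv : v ∈ A) : (fun g => ℓ fun x => v (x * g)) ∈ A := by
  obtain ⟨n, f₁, f₂, h₁, h₂, h⟩ := hA.mul_mem' v hv
  have : (fun g => ℓ fun x => v (x * g)) = ∑ i, ℓ (f₁ i) • f₂ i := by
    ext g
    have h3 : (fun x => v (x * g)) = ∑ i, f₂ i g • f₁ i := by ext x; simp [h, mul_comm]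
    rw [h3]
    simp [mul_comm]
  rw [this]
  exact A.sum_mem fun i _ => A.smul_mem (h₂ i) _

/-- Entries of ρ lift to functions in a right-stable V. Modulo the functions W vanishing on `H`,
each row of ρ spans an `H`-submodule, and evaluation at 1 reads off the identity matrix. So it
suffices to extend the representation of `H` on V/W. -/
theorem hasEquivariantExtensions_of_isQuasiAffine [IsAlgClosed k] (hA : IsAffineAlgebraicGroup A)
    (hq : (homogeneousSpace A H).IsQuasiAffine) : HasEquivariantExtensions A H := by
  intro n ρ hρ
  choose r hrA hr using fun i j => mem_restrictFunctions_iff.1 (hρ i j)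
  obtain ⟨V, _, hVA, hrV, hV⟩ := hA.exists_right_stable (Set.range fun p : Fin n × Fin n => r p.1 p.2)
    (Set.finite_range _) (by rintro _ ⟨p, rfl⟩; exact hrA _ _)
  have hrV' : ∀ i j, r i j ∈ V := fun i j => hrV ⟨(i, j), rfl⟩
  let R : G →* Module.End k V :=
    { toFun := fun g =>
        { toFun := fun v => ⟨fun x => v.1 (x * g), hV v.1 v.2 g⟩
          map_add' := fun _ _ => rfl
          map_smul' := fun _ _ => rfl }
      map_one' := LinearMap.ext fun v => Subtype.ext <| funext fun x => by simp
      map_mul' := fun g g' => LinearMap.ext fun v => Subtype.ext <| funext fun x => by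
        simp [mul_assoc] }
  have hR : ∀ g v x, (R g v).1 x = v.1 (x * g) := fun _ _ _ => rfl
  let W : Submodule k V :=
    { carrier := {v | ∀ h : H, v.1 h = 0}
      zero_mem' := fun h => rfl
      add_mem' := fun hv hw h => by simp [hv h, hw h]
      smul_mem' := fun c v hv h => by simp [hv h] }
  obtain ⟨d, e, b, hb⟩ := W.exists_basis_mem_iff
  let c : G →* Matrix (Fin d ⊕ Fin e) (Fin d ⊕ Fin e) k :=
    (LinearMap.toMatrixAlgEquiv b : (V →ₗ[k] V) →* Matrix _ _ k).comp R
  have hc : ∀ g i j, c g i j = b.repr (R g (b j)) i := fun g i j =>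
    LinearMap.toMatrixAlgEquiv_apply b _ i j
  have hcA : ∀ i j, (fun g => c g i j) ∈ A := fun i j => by
    obtain ⟨ℓ, hℓ⟩ := LinearMap.exists_extend (b.coord i)
    have h1 : (fun g => c g i j) = fun g => ℓ fun x => (b j).1 (x * g) := funext fun g => by
      rw [hc]
      exact (LinearMap.congr_fun hℓ (R g (b j))).symm
    rw [h1]
    exact hA.right_translate_coeff_mem ℓ (hVA (b j).2)
  have hbW : ∀ j, b (Sum.inl j) ∈ W := fun j => (hb _).2 fun i => by simp
  have hRW : ∀ (h : H) v, v ∈ W → R h v ∈ W := fun h v hv h' => hv (h' * h)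
  have hc0 : ∀ (h : H) i j, c h (Sum.inr i) (Sum.inl j) = 0 := fun h i j => by
    rw [hc]
    exact (hb _).1 (hRW h _ (hbW j)) i
  -- On `H` the matrix `c` is block upper triangular: `X₁₁` is the action on W and `X₂₂` the action
  -- on V/W.
  let X₁₁ : G → Matrix (Fin d) (Fin d) k := fun x => (c x).toBlocks₁₁
  let X₁₂ : G → Matrix (Fin d) (Fin e) k := fun x => (c x).toBlocks₁₂
  let X₂₁ : G → Matrix (Fin e) (Fin d) k := fun x => (c x).toBlocks₂₁
  let X₂₂ : G → Matrix (Fin e) (Fin e) k := fun x => (c x).toBlocks₂₂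
  have hblock : ∀ (x : G) (h : H),
      X₁₁ (x * h) = X₁₁ x * X₁₁ h ∧ X₁₂ (x * h) = X₁₁ x * X₁₂ h + X₁₂ x * X₂₂ h ∧
      X₂₁ (x * h) = X₂₁ x * X₁₁ h ∧ X₂₂ (x * h) = X₂₁ x * X₁₂ h + X₂₂ x * X₂₂ h := by
    intro x h
    refine ⟨?_, ?_, ?_, ?_⟩ <;> ext i j <;>
      simp [X₁₁, X₁₂, X₂₁, X₂₂, Matrix.toBlocks₁₁, Matrix.toBlocks₁₂, Matrix.toBlocks₂₁,
        Matrix.toBlocks₂₂, Matrix.mul_apply, hc0]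
  have hX1 : X₁₁ 1 = 1 ∧ X₁₂ 1 = 0 ∧ X₂₁ 1 = 0 ∧ X₂₂ 1 = 1 := by
    refine ⟨?_, ?_, ?_, ?_⟩ <;> ext i j <;>
      simp [X₁₁, X₁₂, X₂₁, X₂₂, Matrix.toBlocks₁₁, Matrix.toBlocks₁₂, Matrix.toBlocks₂₁,
        Matrix.toBlocks₂₂, Matrix.one_apply]
  obtain ⟨hdet, hadj⟩ := det_mem_and_adjugate_mem X₁₁ (fun i j => hcA _ _)
  obtain ⟨f, hf, hf1, hfχ⟩ := exists_inverse_semiinvariant hA hq (fun x => (X₁₁ x).det) hdet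
    (by simp [hX1.1]) (fun h => (X₁₁ h).det) (fun x h => by simp [(hblock x h).1])
  -- The Schur complement extends the action on V/W up to the weight det `X₁₁`, which `f` cancels.
  let a₁ : G → Matrix (Fin e) (Fin e) k := fun x =>
    f x • ((X₁₁ x).det • X₂₂ x - X₂₁ x * (X₁₁ x).adjugate * X₁₂ x)
  have ha₁A : ∀ i j, (fun x => a₁ x i j) ∈ A := fun i j =>
    A.mul_mem hf (A.sub_mem (A.mul_mem hdet (hcA _ _))
      (matrix_mul_mem (matrix_mul_mem (fun _ _ => hcA _ _) hadj) (fun _ _ => hcA _ _) i j))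
  have ha₁1 : a₁ 1 = 1 := by simp [a₁, hX1, hf1]
  have ha₁mul : ∀ (x : G) (h : H), a₁ (x * h) = a₁ x * X₂₂ h := by
    intro x h
    obtain ⟨h11, h12, h21, h22⟩ := hblock x h
    simp only [a₁, h11, h12, h21, h22, Matrix.schur_mul_upper, smul_smul, hfχ, Matrix.smul_mul]
  -- The columns of `D i` are the classes in V/W of the i-th row of lifts `r i s`; `D i` intertwines
  -- ρ with `X₂₂`.
  let D : Fin n → Matrix (Fin e) (Fin n) k := fun i => Matrix.of fun p s =>
    b.repr ⟨r i s, hrV' i s⟩ (Sum.inr p)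
  have hD : ∀ i (h : H), X₂₂ h * D i = D i * ρ h := by
    intro i h
    ext p s
    have h1 : R h ⟨r i s, hrV' i s⟩ - ∑ t, ρ h t s • (⟨r i t, hrV' i t⟩ : V) ∈ W := by
      intro h'
      have h2 : (R h ⟨r i s, hrV' i s⟩ - ∑ t, ρ h t s • (⟨r i t, hrV' i t⟩ : V)).1 h' =
          r i s (h' * h) - ∑ t, ρ h t s * r i t h' := by
        simp [hR]
      rw [h2]
      have h3 := hr i s (h' * h)
      rw [map_mul, Matrix.mul_apply] at h3
      rw [show r i s (h' * h) = _ from h3.symm, sub_eq_zero]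
      exact Finset.sum_congr rfl fun t _ => by rw [hr i t h', mul_comm]
    have h4 := (hb _).1 h1 p
    rw [map_sub, Finsupp.sub_apply, sub_eq_zero] at h4
    have h5 : ∀ v, b.repr (R h v) (Sum.inr p) = ∑ q, X₂₂ h p q * b.repr v (Sum.inr q) := by
      intro v
      conv_lhs => rw [← b.sum_repr v]
      simp only [map_sum, map_smul, Finsupp.coe_finsetSum, Finset.sum_apply, Finsupp.smul_apply,
        smul_eq_mul, ← hc]
      rw [Fintype.sum_sum_type]
      simp only [hc0, mul_zero, Finset.sum_const_zero, zero_add]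
      exact Finset.sum_congr rfl fun q _ => mul_comm _ _
    rw [h5] at h4
    simp only [map_sum, map_smul, Finsupp.coe_finsetSum, Finset.sum_apply, Finsupp.smul_apply,
        smul_eq_mul] at h4
    rw [Matrix.mul_apply, Matrix.mul_apply]
    refine h4.trans (Finset.sum_congr rfl fun q _ => mul_comm _ _)
  -- Evaluation at 1, well defined on V/W because 1 lies in `H`.
  let w : Fin e → k := fun p => (b (Sum.inr p)).1 1
  have hw : ∀ i s, ∑ p, w p * D i p s = (1 : Matrix (Fin n) (Fin n) k) i s := by
    intro i s
    have h1 := hr i s 1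
    rw [map_one] at h1
    rw [h1]
    have h2 := congrFun (congrArg Subtype.val (b.sum_repr ⟨r i s, hrV' i s⟩)) 1
    have h3 : ∀ j, (b (Sum.inl j)).1 1 = 0 := fun j => hbW j 1
    rw [Fintype.sum_sum_type] at h2
    simp only [Submodule.coe_add, Submodule.coe_sum, Submodule.coe_smul, Pi.add_apply,
      Finset.sum_apply, Pi.smul_apply, h3, smul_eq_mul, mul_zero, Finset.sum_const_zero,
      zero_add] at h2
    exact (Finset.sum_congr rfl fun p _ => mul_comm _ _).trans h2
  refine ⟨fun x => Matrix.of fun i s => Matrix.vecMul w (a₁ x * D i) s, fun i s => ?_, ?_, ?_⟩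
  · have h1 : (fun x => Matrix.vecMul w (a₁ x * D i) s) = ∑ p, w p • fun x => (a₁ x * D i) p s := by
      ext x; simp [Matrix.vecMul, dotProduct]
    change (fun x => Matrix.vecMul w (a₁ x * D i) s) ∈ A
    rw [h1]
    exact A.sum_mem fun p _ => A.smul_mem (matrix_mul_mem ha₁A
      (fun p s => A.algebraMap_mem (D i p s)) p s) _
  · ext i s
    change Matrix.vecMul w (a₁ 1 * D i) s = _
    rw [← hw, ha₁1, Matrix.one_mul]
    rfl
  · intro x h
    ext i s
    change Matrix.vecMul w (a₁ (x * h) * D i) s = _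
    rw [ha₁mul, Matrix.mul_assoc, hD, ← Matrix.mul_assoc, ← Matrix.vecMul_vecMul]
    rfl

end QuasiAffine

/-! ### Generic descent and Chevalley's theorem over a reduced ring -/

section CommutativeAlgebra

open scoped TensorProduct

/-- A nonzero algebra over a field is faithfully flat, so faithfully flat descent of elements
applies. -/
theorem mem_range_algebraMap_of_tmul_one_eq {K L : Type*} [Field K] [CommRing L] [Algebra K L]
    {f : L} (hf : f ⊗ₜ[K] (1 : L) = 1 ⊗ₜ f) : f ∈ Set.range (algebraMap K L) := by
  cases subsingleton_or_nontrivial L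
  · exact ⟨0, Subsingleton.elim _ _⟩
  · rw [← (Algebra.IsEffective.of_faithfullyFlat K L).eqLocus_includeLeft_includeRight]
    exact hf

variable {R S : Type*} [CommRing R] [IsReduced R] [CommRing S] [Algebra R S]

/-- A reduced local ring of dimension zero is a field. -/
theorem isField_localization_atPrime_of_mem_minimalPrimes (p : Ideal R) (hp : p ∈ minimalPrimes R) :
    haveI := hp.1.1
    IsField (Localization.AtPrime p) := by
  have := hp.1.1
  have := Ring.KrullDimLE.of_isLocalization p hp (Localization.AtPrime p)
  have : IsReduced (Localization.AtPrime p) :=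
    isReduced_localizationPreserves p.primeCompl (Localization.AtPrime p) inferInstance
  exact Ring.KrullDimLE.isField_of_isReduced

theorem exists_notMem_mul_eq_zero_of_mem_minimalPrimes {p : Ideal R} (hp : p ∈ minimalPrimes R)
    {g : R} (hg : g ∈ p) : ∃ t, t ∉ p ∧ t * g = 0 := by
  have := hp.1.1
  have hnu : ¬ IsUnit (algebraMap R (Localization.AtPrime p) g) := by
    rw [IsLocalization.AtPrime.isUnit_to_map_iff (Localization.AtPrime p) p]
    exact fun h => h hg
  have h0 : algebraMap R (Localization.AtPrime p) g = 0 := by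
    by_contra hne
    obtain ⟨b, hb⟩ := (isField_localization_atPrime_of_mem_minimalPrimes p hp).mul_inv_cancel hne
    exact hnu (IsUnit.of_mul_eq_one b hb)
  obtain ⟨t, ht⟩ := (IsLocalization.map_eq_zero_iff p.primeCompl _ g).1 h0
  exact ⟨t, t.2, ht⟩

/-- The relation persists after localizing at `p`, where the base is a field and f descends;
clearing denominators gives s. -/
theorem exists_smul_mem_range_of_tmul_one_eq {p : Ideal R} (hp : p ∈ minimalPrimes R)
    {f : S} (hf : f ⊗ₜ[R] (1 : S) = 1 ⊗ₜ f) :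
    ∃ s, s ∉ p ∧ s • f ∈ Set.range (algebraMap R S) := by
  have := hp.1.1
  let M := p.primeCompl
  let K := Localization.AtPrime p
  let L := Localization (Algebra.algebraMapSubmonoid S M)
  let : Field K := (isField_localization_atPrime_of_mem_minimalPrimes p hp).toField
  let i₁ : S →ₐ[R] L ⊗[K] L :=
    ((Algebra.TensorProduct.includeLeft : L →ₐ[K] L ⊗[K] L).restrictScalars R).comp
    (IsScalarTower.toAlgHom R S L)
  let i₂ : S →ₐ[R] L ⊗[K] L :=
    ((Algebra.TensorProduct.includeRight : L →ₐ[K] L ⊗[K] L).restrictScalars R).comp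
    (IsScalarTower.toAlgHom R S L)
  have h1 := congrArg (Algebra.TensorProduct.lift i₁ i₂ fun _ _ => Commute.all _ _) hf
  rw [Algebra.TensorProduct.lift_tmul, Algebra.TensorProduct.lift_tmul, map_one, map_one, mul_one,
    one_mul] at h1
  obtain ⟨c, hc⟩ := mem_range_algebraMap_of_tmul_one_eq (K := K) (f := algebraMap S L f) h1
  obtain ⟨⟨r, s⟩, hrs⟩ := IsLocalization.surj M c
  have h2 : algebraMap S L (s.1 • f) = algebraMap S L (algebraMap R S r) := by
    rw [← IsScalarTower.algebraMap_apply, IsScalarTower.algebraMap_apply R K L, ← hrs, map_mul, hc,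
      ← IsScalarTower.algebraMap_apply, Algebra.smul_def, map_mul, ← IsScalarTower.algebraMap_apply,
      mul_comm]
  obtain ⟨⟨_, t, ht, rfl⟩, hte⟩ :=
    (IsLocalization.eq_iff_exists (Algebra.algebraMapSubmonoid S M) L).1 h2
  refine ⟨t * s, M.mul_mem ht s.2, t * r, ?_⟩
  rw [map_mul, mul_smul, Algebra.smul_def t]
  exact hte.symm

/-- The image of a dominant map of finite presentation contains a nonempty open set. -/
theorem exists_basicOpen_subset_range_comap {p : Ideal R} (hp : p ∈ minimalPrimes R)
    [Algebra.FinitePresentation R S] (hinj : Function.Injective (algebraMap R S)) :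
    ∃ s, s ∉ p ∧ ∀ q : PrimeSpectrum R, s ∉ q.asIdeal →
      q ∈ Set.range (PrimeSpectrum.comap (algebraMap R S)) := by
  have hp' := hp.1.1
  have hcons := PrimeSpectrum.isConstructible_range_comap
    (RingHom.finitePresentation_algebraMap.mpr ‹Algebra.FinitePresentation R S›)
  obtain ⟨D, hD⟩ := PrimeSpectrum.exists_constructibleSetData_iff.2 hcons
  -- A minimal prime is hit by an injective extension, so `p` lies in one of the locally closed
  -- pieces of the constructible image.
  obtain ⟨p', hp'', hcomap⟩ := Ideal.exists_comap_eq_of_mem_minimalPrimes_of_injective hinj p hp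
  have hmem : (⟨p, hp'⟩ : PrimeSpectrum R) ∈ D.toSet := by
    rw [hD]
    exact ⟨⟨p', hp''⟩, PrimeSpectrum.ext hcomap⟩
  rw [PrimeSpectrum.ConstructibleSetData.toSet, Set.mem_iUnion₂] at hmem
  obtain ⟨C, hC, hg, hf⟩ := hmem
  have hg' : ∀ i, C.g i ∈ p := fun i => hg ⟨i, rfl⟩
  have hf' : C.f ∉ p := fun h => hf (by simpa [PrimeSpectrum.mem_zeroLocus] using h)
  -- Where all `t i` are nonzero the closed conditions of that piece hold automatically, so the
  -- piece contains a principal open set.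
  choose t htp ht using fun i => exists_notMem_mul_eq_zero_of_mem_minimalPrimes hp (hg' i)
  refine ⟨C.f * ∏ i, t i, ?_, fun q hq => ?_⟩
  · refine p.primeCompl.mul_mem hf' (p.primeCompl.prod_mem fun i _ => htp i)
  · rw [← hD, PrimeSpectrum.ConstructibleSetData.toSet, Set.mem_iUnion₂]
    refine ⟨C, hC, ?_, fun h => ?_⟩
    · rintro _ ⟨i, rfl⟩
      refine (q.2.mem_or_mem (show t i * C.g i ∈ q.asIdeal by rw [ht]; exact zero_mem _)
        ).resolve_left fun h => hq ?_
      exact Ideal.mul_mem_left _ _ (Ideal.mem_of_dvd _ (Finset.dvd_prod_of_mem t (Finset.mem_univ i)) h)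
    · refine hq (Ideal.mul_mem_right _ _ ?_)
      simpa [PrimeSpectrum.mem_zeroLocus] using h

end CommutativeAlgebra

/-! ### Producing invariant functions from equivariant matrices -/

section Invariants

variable {k : Type u} [Field k] {G : Type v} [Group G] {A : Subalgebra k (G → k)} {H : Subgroup G}

/-- The polynomial functions on `G` that are invariant under right translation by `H`. -/
def invariantFunctions (A : Subalgebra k (G → k)) (H : Subgroup G) : Subalgebra k (G → k) where
  carrier := {f | f ∈ A ∧ ∀ (x : G) (h : H), f (x * h) = f x}
  mul_mem' := fun ha hb => ⟨A.mul_mem ha.1 hb.1, fun x h => by simp [ha.2, hb.2]⟩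
  add_mem' := fun ha hb => ⟨A.add_mem ha.1 hb.1, fun x h => by simp [ha.2, hb.2]⟩
  algebraMap_mem' := fun r => ⟨A.algebraMap_mem r, fun x h => rfl⟩

theorem IsAffineAlgebraicGroup.mul_left_mem_invariantFunctions (hA : IsAffineAlgebraicGroup A)
    {f : G → k} (hf : f ∈ invariantFunctions A H) (g : G) :
    (fun x => f (g * x)) ∈ invariantFunctions A H :=
  ⟨hA.mul_left_mem hf.1 g, fun x h => by
    change f (g * (x * h)) = f (g * x)
    rw [← mul_assoc, hf.2]⟩

/-- Finitely many polynomial functions vanishing on a right `H`-stable set lie in the span of a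
family `w` of such functions for which there is a matrix `a` with `a(1) = 1` and `a * w` invariant. -/
theorem HasEquivariantExtensions.exists_frame (hA : IsAffineAlgebraicGroup A)
    (hext : HasEquivariantExtensions A H) (Z : Set G) (hZ : ∀ x ∈ Z, ∀ h : H, x * h ∈ Z)
    (S : Set (G → k)) (hS : S.Finite) (hSA : S ⊆ A) (hSZ : ∀ f ∈ S, ∀ z ∈ Z, f z = 0) :
    ∃ (n : ℕ) (w : Fin n → G → k) (a : G → Matrix (Fin n) (Fin n) k),
      (∀ i, w i ∈ A) ∧ (∀ i, ∀ z ∈ Z, w i z = 0) ∧ S ⊆ Submodule.span k (Set.range w) ∧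
      (∀ i j, (fun x => a x i j) ∈ A) ∧ a 1 = 1 ∧
      (∀ (x : G) (h : H), (a x).det = 0 → (a (x * h)).det = 0) ∧
      ∀ (x : G) (h : H), (a (x * h)).mulVec (fun i => w i (x * h)) =
        (a x).mulVec (fun i => w i x) := by
  obtain ⟨V, _, hVA, hSV, hV⟩ := hA.exists_right_stable S hS hSA
  let W : Submodule k (G → k) :=
    { carrier := {f | f ∈ V ∧ ∀ z ∈ Z, f z = 0}
      zero_mem' := ⟨V.zero_mem, fun _ _ => rfl⟩
      add_mem' := fun ha hb => ⟨V.add_mem ha.1 hb.1, fun z hz => by simp [ha.2 z hz, hb.2 z hz]⟩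
      smul_mem' := fun c _ ha => ⟨V.smul_mem c ha.1, fun z hz => by simp [ha.2 z hz]⟩ }
  have : FiniteDimensional k W := Submodule.finiteDimensional_of_le (fun f hf => hf.1 : W ≤ V)
  obtain ⟨n, ⟨b⟩⟩ : ∃ n, Nonempty (Module.Basis (Fin n) k W) := ⟨_, ⟨Module.finBasis k W⟩⟩
  let R : H →* Module.End k W :=
    { toFun := fun g =>
        { toFun := fun v => ⟨fun x => v.1 (x * g), hV v.1 v.2.1 g, fun z hz => v.2.2 _ (hZ z hz g)⟩
          map_add' := fun _ _ => rfl
          map_smul' := fun _ _ => rfl }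
      map_one' := LinearMap.ext fun v => Subtype.ext <| funext fun x => by simp
      map_mul' := fun g g' => LinearMap.ext fun v => Subtype.ext <| funext fun x => by
        simp [mul_assoc] }
  let c : H →* Matrix (Fin n) (Fin n) k :=
    (LinearMap.toMatrixAlgEquiv b : (W →ₗ[k] W) →* Matrix _ _ k).comp R
  have hc : ∀ g i j, c g i j = b.repr (R g (b j)) i := fun g i j =>
    LinearMap.toMatrixAlgEquiv_apply b _ i j
  -- The basis of W transforms by w(xh) = c(h)ᵀ w(x). The contragredient is extended, so that the
  -- two factors cancel in a · w.
  let ρ : H →* Matrix (Fin n) (Fin n) k :=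
    { toFun := fun h => (c h⁻¹).transpose
      map_one' := by simp
      map_mul' := fun h h' => by simp [Matrix.transpose_mul] }
  have hρ : ∀ h, ρ h = (c h⁻¹).transpose := fun _ => rfl
  obtain ⟨a, ha, ha1, hmul⟩ := hext n ρ (by
    intro i j
    obtain ⟨ℓ, hℓ⟩ := LinearMap.exists_extend (b.coord j)
    refine mem_restrictFunctions_iff.2 ⟨fun g => ℓ fun x => (b i).1 (x * g⁻¹),
      hA.inv_mem' _ (hA.right_translate_coeff_mem ℓ (hVA (b i).2.1)), fun h => ?_⟩
    rw [hρ, Matrix.transpose_apply, hc]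
    exact (LinearMap.congr_fun hℓ (R h⁻¹ (b i))).symm)
  have hw : ∀ (x : G) (h : H), (fun i => (b i).1 (x * h)) =
      (c h).transpose.mulVec fun i => (b i).1 x := by
    intro x h
    ext j
    have h1 := congrFun (congrArg Subtype.val (b.sum_repr (R h (b j)))) x
    rw [← show (R h (b j)).1 x = (b j).1 (x * h) from rfl, ← h1]
    simp only [Submodule.coe_sum, Submodule.coe_smul, Finset.sum_apply, Pi.smul_apply, smul_eq_mul,
      Matrix.mulVec, dotProduct, Matrix.transpose_apply, hc]
  refine ⟨n, fun i => (b i).1, a, fun i => hVA (b i).2.1, fun i => (b i).2.2, fun f hf => ?_, ha,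
    ha1, fun x h hx => by rw [hmul, Matrix.det_mul, hx, zero_mul], fun x h => ?_⟩
  · have h1 := congrArg Subtype.val (b.sum_repr ⟨f, hSV hf, hSZ f hf⟩)
    simp only [Submodule.coe_sum, Submodule.coe_smul] at h1
    rw [← h1]
    exact Submodule.sum_mem _ fun i _ => Submodule.smul_mem _ _ (Submodule.subset_span ⟨i, rfl⟩)
  · rw [hw, hmul, Matrix.mulVec_mulVec, hρ, Matrix.mul_assoc, ← Matrix.transpose_mul, ← map_mul,
      mul_inv_cancel, map_one, Matrix.transpose_one, Matrix.mul_one]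

theorem mulVec_mem {X n : Type*} [Fintype n] {A : Subalgebra k (X → k)} {a : X → Matrix n n k}
    {w : n → X → k} (ha : ∀ i j, (fun x => a x i j) ∈ A) (hw : ∀ i, w i ∈ A) (i : n) :
    (fun x => (a x).mulVec (fun i => w i x) i) ∈ A := by
  have : (fun x => (a x).mulVec (fun i => w i x) i) = ∑ j, (fun x => a x i j) * w j := by
    ext x; simp [Matrix.mulVec, dotProduct]
  rw [this]
  exact A.sum_mem fun j _ => A.mul_mem (ha i j) (hw j)

/-- The invariant functions define the quotient topology of `G/H`. -/
theorem HasEquivariantExtensions.exists_invariant (hA : IsAffineAlgebraicGroup A)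
    (hext : HasEquivariantExtensions A H) (U : Set G) (hU : @IsOpen G (zariskiTopology A) U)
    (hUH : ∀ (x : G) (h : H), x * h ∈ U → x ∈ U) (x₀ : G) (hx₀ : x₀ ∈ U) :
    ∃ g ∈ invariantFunctions A H, (∀ x, x ∉ U → g x = 0) ∧ g x₀ ≠ 0 := by
  obtain ⟨s, hs, hs0, hsU⟩ := isOpen_zariskiTopology_iff.1 hU x₀ hx₀
  -- The matrix `a` is only controlled at 1, so `x₀` is moved to 1 and the invariant is translated
  -- back afterwards.
  obtain ⟨n, w, a, hwA, hwZ, hsw, haA, ha1, -, hinv⟩ := hext.exists_frame hA {x | x₀ * x ∉ U}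
    (fun x hx h hxh => hx (hUH _ h (by rwa [mul_assoc]))) {fun x => s (x₀ * x)}
    (Set.finite_singleton _) (by simpa using hA.mul_left_mem hs x₀) (by
      rintro _ rfl z hz
      by_contra hne
      exact hz (hsU _ hne))
  obtain ⟨i, hi⟩ : ∃ i, w i 1 ≠ 0 := by
    by_contra! hall
    have h1 : Submodule.span k (Set.range w) ≤ LinearMap.ker (LinearMap.proj 1) := by
      refine Submodule.span_le.2 ?_
      rintro _ ⟨i, rfl⟩
      exact hall i
    have h2 : s (x₀ * 1) = 0 := h1 (hsw rfl)
    exact hs0 (by simpa using h2)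
  have hF : (fun x => (a x).mulVec (fun i => w i x) i) ∈ invariantFunctions A H :=
    ⟨mulVec_mem haA hwA i, fun x h => congrFun (hinv x h) i⟩
  refine ⟨_, hA.mul_left_mem_invariantFunctions hF x₀⁻¹, fun x hx => ?_, ?_⟩
  · have h1 : (fun i => w i (x₀⁻¹ * x)) = 0 := funext fun i => hwZ i _ (by simpa using hx)
    simp [h1]
  · simpa [ha1] using hi

/-- Near `H` the ideal of `H` is generated by invariant functions. -/
theorem HasEquivariantExtensions.exists_generators [IsAlgClosed k] (hA : IsAffineAlgebraicGroup A)
    (hext : HasEquivariantExtensions A H) :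
    ∃ (n : ℕ) (F : Fin n → A) (b : A), (∀ i, (F i).1 ∈ invariantFunctions A H) ∧
      (∀ i, (F i).1 1 = 0) ∧ b.1 ∈ invariantFunctions A H ∧ b.1 1 ≠ 0 ∧
      ∀ f : A, (∀ h : H, f.1 h = 0) → b * f ∈ Ideal.span (Set.range F) := by
  have : Algebra.FiniteType k A := A.fg_iff_finiteType.mp hA.fg
  have : IsNoetherianRing A := Algebra.FiniteType.isNoetherianRing k A
  let I : Ideal A :=
    { carrier := {f | ∀ h : H, f.1 h = 0}
      zero_mem' := fun h => rfl
      add_mem' := fun ha hb h => by simp [ha h, hb h]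
      smul_mem' := fun c f hf h => by simp [hf h] }
  obtain ⟨S, hS⟩ := IsNoetherian.noetherian I
  have hSI : ∀ f ∈ S, f ∈ I := fun f hf => hS ▸ Ideal.subset_span hf
  obtain ⟨n, w, a, hwA, hwZ, hSw, haA, ha1, hdet0, hinv⟩ := hext.exists_frame hA (H : Set G)
    (fun x hx h => H.mul_mem hx h.2) (Subtype.val '' (S : Set A)) (S.finite_toSet.image _)
    (by rintro _ ⟨f, -, rfl⟩; exact f.2)
    (by rintro _ ⟨f, hf, rfl⟩ z hz; exact hSI f hf ⟨z, hz⟩)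
  obtain ⟨hdet, hadj⟩ := det_mem_and_adjugate_mem a haA
  let F : Fin n → A := fun i => ⟨_, mulVec_mem haA hwA i⟩
  let δ : A := ⟨_, hdet⟩
  -- The adjugate gives δ I ⊆ (F), but δ = det a need not be invariant. A power of the invariant `g`
  -- is a multiple of δ and replaces it.
  obtain ⟨g, hg, hg0, hg1⟩ := hext.exists_invariant hA {x | (a x).det ≠ 0}
    (isOpen_zariskiTopology_ne_zero hdet) (fun x h hxh hx => hxh (hdet0 x h hx)) 1
    (by simp [ha1])
  obtain ⟨N, hN⟩ := hA.exists_pow_mem (Ideal.span {δ}) ⟨g, hg.1⟩ (fun x hx =>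
    hg0 x fun hne => hne (hx δ (Ideal.mem_span_singleton_self _)))
  have hδw : ∀ i, δ * ⟨w i, hwA i⟩ ∈ Ideal.span (Set.range F) := by
    intro i
    have h1 : δ * ⟨w i, hwA i⟩ = ∑ j, (⟨_, hadj i j⟩ : A) * F j := by
      refine Subtype.ext (funext fun x => ?_)
      have h2 : ((a x).adjugate.mulVec ((a x).mulVec fun i => w i x)) i = (a x).det * w i x := by
        rw [Matrix.mulVec_mulVec, Matrix.adjugate_mul]
        simp [Matrix.smul_mulVec]
      change (a x).det * w i x = _
      rw [← h2]
      simp [Matrix.mulVec, dotProduct, F]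
    rw [h1]
    exact Ideal.sum_mem _ fun j _ => Ideal.mul_mem_left _ _ (Ideal.subset_span ⟨j, rfl⟩)
  have hδI : ∀ f ∈ I, δ * f ∈ Ideal.span (Set.range F) := by
    intro f hf
    rw [← hS] at hf
    refine Submodule.span_induction (fun f hf => ?_) (by simp) (fun f f' _ _ h h' => ?_)
      (fun r f _ h => ?_) hf
    · let Q : Submodule k (G → k) :=
        ((Ideal.span (Set.range F)).restrictScalars k |>.comap (LinearMap.mulLeft k δ)).map
          A.val.toLinearMap
      have h1 : Submodule.span k (Set.range w) ≤ Q := by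
        refine Submodule.span_le.2 ?_
        rintro _ ⟨i, rfl⟩
        exact ⟨⟨w i, hwA i⟩, hδw i, rfl⟩
      obtain ⟨f', hf', hff'⟩ := h1 (hSw ⟨f, hf, rfl⟩)
      have : f' = f := Subtype.ext hff'
      exact this ▸ hf'
    · rw [mul_add]; exact Ideal.add_mem _ h h'
    · rw [smul_eq_mul, mul_left_comm]; exact Ideal.mul_mem_left _ _ h
  refine ⟨n, F, ⟨g, hg.1⟩ ^ N, fun i => ⟨(F i).2, fun x h => congrFun (hinv x h) i⟩, fun i => ?_,
    (invariantFunctions A H).pow_mem hg N, pow_ne_zero N hg1, fun f hf => ?_⟩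
  · have h1 : (fun i => w i 1) = 0 := funext fun i => hwZ i 1 H.one_mem
    simp [F, h1]
  · obtain ⟨q, hq⟩ := Ideal.mem_span_singleton'.1 hN
    rw [← hq, mul_assoc]
    exact Ideal.mul_mem_left _ _ (hδI f hf)

end Invariants

/-! ### Tensor squares, points in k-algebras and the descent condition -/

section Descent

open scoped TensorProduct

variable {k : Type u} [Field k] {G : Type v} [Group G] {A : Subalgebra k (G → k)} {H : Subgroup G}

/-- The tensor square of an algebra of functions on `X` as an algebra of functions on `X × X`. -/
noncomputable def tensorToFun {X : Type v} (A : Subalgebra k (X → k)) :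
    A ⊗[k] A →ₐ[k] (X × X → k) :=
  Algebra.TensorProduct.lift
    ((AlgHom.pi fun p : X × X => Pi.evalAlgHom k (fun _ : X => k) p.1).comp A.val)
    ((AlgHom.pi fun p : X × X => Pi.evalAlgHom k (fun _ : X => k) p.2).comp A.val)
    fun _ _ => Commute.all _ _

theorem tensorToFun_tmul {X : Type v} {A : Subalgebra k (X → k)} (f g : A) (x y : X) :
    tensorToFun A (f ⊗ₜ g) (x, y) = f.1 x * g.1 y := by
  simp [tensorToFun]

/-- Expand the second factor in a basis of `A`; for fixed x the coefficients vanish by linear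
independence. Identities in A ⊗ A can thus be checked pointwise. -/
theorem tensorToFun_injective {X : Type v} (A : Subalgebra k (X → k)) :
    Function.Injective (tensorToFun A) := by
  classical
  rw [injective_iff_map_eq_zero]
  intro t ht
  let b := Module.Basis.ofVectorSpace k A
  let e := TensorProduct.equivFinsuppOfBasisRight (M := A) b
  obtain ⟨c, rfl⟩ : ∃ c, t = e.symm c := ⟨e t, by simp⟩
  have h1 : e.symm c = c.sum fun i m => m ⊗ₜ b i := by
    simp [e]
  rw [h1] at ht
  have h2 : c = 0 := by
    ext i x
    have h3 : ∑ j ∈ c.support, (c j).1 x • b j = 0 := by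
      refine Subtype.ext (funext fun y => ?_)
      have h4 := congrFun ht (x, y)
      simp only [Finsupp.sum, map_sum, Finset.sum_apply, tensorToFun_tmul] at h4
      simpa using h4
    by_cases hi : i ∈ c.support
    · exact linearIndependent_iff'.1 b.linearIndependent c.support (fun j => (c j).1 x) h3 i hi
    · simp [Finsupp.notMem_support_iff.1 hi]
  simp [h2]

/-- The translates of f stay in a finite-dimensional left-stable subspace of `P`; their coordinates
in a basis of it are polynomial. The point is that the right factors lie in `P`. -/
theorem IsAffineAlgebraicGroup.exists_coaction (hA : IsAffineAlgebraicGroup A)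
    (P : Submodule k (G → k)) (hPA : P ≤ Subalgebra.toSubmodule A)
    (hP : ∀ f ∈ P, ∀ g : G, (fun x => f (g * x)) ∈ P) (f : G → k) (hf : f ∈ P) :
    ∃ (n : ℕ) (p q : Fin n → A), (∀ i, (q i).1 ∈ P) ∧
      ∀ x y, f (x * y) = ∑ i, (p i).1 x * (q i).1 y := by
  obtain ⟨V, _, hVP, hfV, hV⟩ := hA.exists_left_stable {f} (Set.finite_singleton f) P hPA hP
    (by simpa using hf)
  let b := Module.finBasis k V
  obtain ⟨m, f₁, f₂, h₁, h₂, h⟩ := hA.mul_mem' f (hPA hf)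
  choose ℓ hℓ using fun i => LinearMap.exists_extend (b.coord i)
  refine ⟨_, fun i => ⟨∑ j, ℓ i (f₂ j) • f₁ j, A.sum_mem fun j _ => A.smul_mem (h₁ j) _⟩,
    fun i => ⟨(b i).1, hPA (hVP (b i).2)⟩, fun i => hVP (b i).2, fun x y => ?_⟩
  let v : V := ⟨fun y => f (x * y), hV f (hfV rfl) x⟩
  have hv : v.1 = ∑ j, f₁ j x • f₂ j := by ext y; simp [v, h]
  have h3 := congrFun (congrArg Subtype.val (b.sum_repr v)) y
  change _ = f (x * y) at h3
  rw [← h3]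
  simp only [Submodule.coe_sum, Submodule.coe_smul, Finset.sum_apply, Pi.smul_apply, smul_eq_mul]
  refine Finset.sum_congr rfl fun i _ => ?_
  have h4 : b.repr v i = ℓ i v.1 := (LinearMap.congr_fun (hℓ i) v).symm
  rw [h4, hv]
  simp [mul_comm]

/-- Left translation by `g` as an endomorphism of the algebra of polynomial functions. -/
def IsAffineAlgebraicGroup.leftTranslate (hA : IsAffineAlgebraicGroup A) (g : G) : A →ₐ[k] A where
  toFun f := ⟨fun x => f.1 (g * x), hA.mul_left_mem f.2 g⟩
  map_one' := rfl
  map_mul' _ _ := rfl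
  map_zero' := rfl
  map_add' _ _ := rfl
  commutes' _ := rfl

theorem IsAffineAlgebraicGroup.exists_tensor_inv_mul (hA : IsAffineAlgebraicGroup A) :
    ∃ Δ : A →ₐ[k] A ⊗[k] A, ∀ f x y, tensorToFun A (Δ f) (x, y) = f.1 (x⁻¹ * y) := by
  let c : A →ₐ[k] (G × G → k) :=
    (AlgHom.pi fun p : G × G => Pi.evalAlgHom k (fun _ : G => k) (p.1⁻¹ * p.2)).comp A.val
  have hc : ∀ f, c f ∈ (tensorToFun A).range := by
    intro f
    obtain ⟨n, f₁, f₂, h₁, h₂, h⟩ := hA.mul_mem' f.1 f.2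
    refine ⟨∑ i, ⟨_, hA.inv_mem' _ (h₁ i)⟩ ⊗ₜ ⟨_, h₂ i⟩, funext fun p => ?_⟩
    obtain ⟨x, y⟩ := p
    change tensorToFun A _ (x, y) = f.1 (x⁻¹ * y)
    rw [h, map_sum, Finset.sum_apply]
    exact Finset.sum_congr rfl fun i _ => tensorToFun_tmul _ _ _ _
  refine ⟨(AlgEquiv.ofInjective _ (tensorToFun_injective A)).symm.toAlgHom.comp
    (c.codRestrict _ hc), fun f x y => ?_⟩
  have h1 := congrArg Subtype.val ((AlgEquiv.ofInjective _ (tensorToFun_injective A)).apply_symm_apply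
    (c.codRestrict _ hc f))
  exact congrFun h1 (x, y)

/-- Let `B` be a left-stable algebra of polynomial functions that contains generators of the ideal
of `H` near `H`. If two points of `G` with values in a `k`-algebra `T` agree on `B`, then they agree
on all invariant functions. -/
theorem algHom_eq_of_generators (hA : IsAffineAlgebraicGroup A) (B : Subalgebra k A)
    (hBstab : ∀ g, ∀ f ∈ B, hA.leftTranslate g f ∈ B)
    {n : ℕ} (F : Fin n → A) (b : A) (hFB : ∀ i, F i ∈ B) (hF1 : ∀ i, (F i).1 1 = 0) (hbB : b ∈ B)
    (hb1 : b.1 1 ≠ 0)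
    (hgen : ∀ f : A, (∀ h : H, f.1 h = 0) → b * f ∈ Ideal.span (Set.range F))
    {T : Type*} [CommRing T] [Algebra k T] (i₁ i₂ : A →ₐ[k] T) (hi : ∀ f ∈ B, i₁ f = i₂ f)
    (f : A) (hf : f.1 ∈ invariantFunctions A H) : i₁ f = i₂ f := by
  obtain ⟨Δ, hΔ⟩ := hA.exists_tensor_inv_mul
  let ψ : A ⊗[k] A →ₐ[k] T := Algebra.TensorProduct.lift i₁ i₂ fun _ _ => Commute.all _ _
  have hψ : ∀ p q : A, ψ (p ⊗ₜ q) = i₁ p * i₂ q := fun p q =>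
    Algebra.TensorProduct.lift_tmul _ _ _ _ _
  -- If i₁, i₂ are points x, y of `G` with values in `T`, then θ is the point x⁻¹y.
  let θ : A →ₐ[k] T := ψ.comp Δ
  -- Since x and y agree on the right factors in `B`, f(x⁻¹y) = Σ p(x⁻¹)q(y) = Σ p(x⁻¹)q(x) = f(1).
  have hθB : ∀ f ∈ B, θ f = algebraMap k _ (f.1 1) := by
    intro f hf
    obtain ⟨m, p, q, hq, hpq⟩ := hA.exists_coaction ((Subalgebra.toSubmodule B).map A.val.toLinearMap)
      (by rintro _ ⟨f, -, rfl⟩; exact f.2)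
      (by rintro _ ⟨f, hf, rfl⟩ g; exact ⟨_, hBstab g f hf, rfl⟩) f.1 ⟨f, hf, rfl⟩
    have hqB : ∀ i, q i ∈ B := fun i => by
      obtain ⟨q', hq', hqq'⟩ := hq i
      have : q' = q i := Subtype.ext hqq'
      exact this ▸ hq'
    let p' : Fin m → A := fun i => ⟨_, hA.inv_mem' _ (p i).2⟩
    have h1 : Δ f = ∑ i, p' i ⊗ₜ q i := by
      refine tensorToFun_injective A (funext fun ⟨x, y⟩ => ?_)
      rw [hΔ, hpq, map_sum, Finset.sum_apply]
      exact Finset.sum_congr rfl fun i _ => (tensorToFun_tmul _ _ _ _).symm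
    have h2 : ∑ i, p' i * q i = algebraMap k A (f.1 1) := by
      refine Subtype.ext (funext fun x => ?_)
      have h3 := hpq x⁻¹ x
      rw [inv_mul_cancel] at h3
      change _ = f.1 1
      rw [h3]
      simp [p']
    have h4 : ∀ i, ψ (p' i ⊗ₜ q i) = i₁ (p' i * q i) := fun i => by
      rw [hψ, map_mul, hi _ (hqB i)]
    change ψ (Δ f) = _
    rw [h1, map_sum]
    simp only [h4]
    rw [← map_sum, h2, AlgHom.commutes]
  -- So x⁻¹y is a `T`-point of `H`: the generators vanish on it, and `b` takes there the nonzero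
  -- scalar value b(1).
  have hθI : ∀ s : A, (∀ h : H, s.1 h = 0) → θ s = 0 := by
    intro s hs
    have h1 : Ideal.span (Set.range F) ≤ RingHom.ker θ := by
      refine Ideal.span_le.2 ?_
      rintro _ ⟨i, rfl⟩
      change θ (F i) = 0
      rw [hθB _ (hFB i), hF1, map_zero]
    have h2 : θ (b * s) = 0 := h1 (hgen s hs)
    rw [map_mul, hθB b hbB, ← Algebra.smul_def] at h2
    exact (smul_eq_zero.1 h2).resolve_left hb1
  obtain ⟨m, p, q, hq, hpq⟩ := hA.exists_coaction (Subalgebra.toSubmodule (invariantFunctions A H))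
    (fun f hf => hf.1) (fun f hf g => hA.mul_left_mem_invariantFunctions hf g) f.1 hf
  have hθq : ∀ i, θ (q i) = algebraMap k _ ((q i).1 1) := by
    intro i
    have h1 := hθI (q i - algebraMap k A ((q i).1 1)) (fun h => by
      have h2 := (hq i).2 1 h
      rw [one_mul] at h2
      change (q i).1 h - (q i).1 1 = 0
      rw [h2, sub_self])
    rwa [map_sub, AlgHom.commutes, sub_eq_zero] at h1
  -- This is f(y) = f(x · x⁻¹y) = Σ p(x)q(x⁻¹y); as the q are invariant, q(x⁻¹y) = q(1), and the sum
  -- becomes f(x).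
  have h1 : (1 : A) ⊗ₜ[k] f = ∑ i, (p i ⊗ₜ 1) * Δ (q i) := by
    refine tensorToFun_injective A (funext fun ⟨x, y⟩ => ?_)
    rw [tensorToFun_tmul, map_sum, Finset.sum_apply]
    have h2 := hpq x (x⁻¹ * y)
    rw [mul_inv_cancel_left] at h2
    simp [h2, tensorToFun_tmul, hΔ]
  have h2 : ∑ i, (q i).1 1 • p i = f := by
    refine Subtype.ext (funext fun x => ?_)
    have h3 := hpq x 1
    rw [mul_one] at h3
    rw [h3]
    simp [mul_comm]
  have h3 := congrArg ψ h1
  rw [hψ, map_sum, map_one, one_mul] at h3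
  rw [h3]
  conv_lhs => rw [← h2]
  rw [map_sum]
  refine Finset.sum_congr rfl fun i _ => ?_
  rw [map_mul, hψ, map_one, mul_one]
  change _ = _ * θ (q i)
  rw [hθq, mul_comm, ← Algebra.smul_def, map_smul]

/-- The two inclusions into S ⊗_B S agree on `B`. This ring may be non-reduced, hence the need for
points in arbitrary algebras. -/
theorem Subalgebra.tmul_one_eq_one_tmul_of_forall {k S : Type*} [CommRing k] [CommRing S]
    [Algebra k S] (B : Subalgebra k S) (f : S)
    (h : ∀ i₁ i₂ : S →ₐ[k] S ⊗[B] S, (∀ q ∈ B, i₁ q = i₂ q) → i₁ f = i₂ f) :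
    f ⊗ₜ[B] (1 : S) = 1 ⊗ₜ f :=
  h ((Algebra.TensorProduct.includeLeft : S →ₐ[B] S ⊗[B] S).restrictScalars k)
    ((Algebra.TensorProduct.includeRight : S →ₐ[B] S ⊗[B] S).restrictScalars k)
    fun q hq => Algebra.TensorProduct.tmul_one_eq_one_tmul (A := S) (B := S) (⟨q, hq⟩ : B)

/-- There is a finitely generated left-stable algebra of invariant functions with respect to which
the invariant functions satisfy the descent condition. -/
theorem HasEquivariantExtensions.exists_subalgebra [IsAlgClosed k] (hA : IsAffineAlgebraicGroup A)
    (hext : HasEquivariantExtensions A H) :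
    ∃ B : Subalgebra k A, B.FG ∧ (∀ f ∈ B, f.1 ∈ invariantFunctions A H) ∧
      (∀ g, ∀ f ∈ B, hA.leftTranslate g f ∈ B) ∧
      ∀ f : A, f.1 ∈ invariantFunctions A H → f ⊗ₜ[B] (1 : A) = 1 ⊗ₜ f := by
  obtain ⟨n, F, b, hF, hF1, hb, hb1, hgen⟩ := hext.exists_generators hA
  obtain ⟨V, _, hVP, hSV, hV⟩ := hA.exists_left_stable
    (insert b.1 (Set.range fun i => (F i).1)) ((Set.finite_range _).insert _)
    (Subalgebra.toSubmodule (invariantFunctions A H))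
    (fun f hf => hf.1) (fun f hf g => hA.mul_left_mem_invariantFunctions hf g) (by
      rintro _ (rfl | ⟨i, rfl⟩)
      · exact hb
      · exact hF i)
  let V' : Submodule k A := V.comap A.val.toLinearMap
  let B : Subalgebra k A := Algebra.adjoin k (V' : Set A)
  have hBstab : ∀ g, ∀ f ∈ B, hA.leftTranslate g f ∈ B := by
    intro g
    have : B ≤ B.comap (hA.leftTranslate g) :=
      Algebra.adjoin_le fun f hf => Algebra.subset_adjoin (hV _ hf g)
    exact this
  refine ⟨B, ?_, ?_, hBstab, ?_⟩
  · have : FiniteDimensional k V' :=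
      Module.Finite.of_injective
        (LinearMap.codRestrict V (A.val.toLinearMap ∘ₗ V'.subtype) fun x => x.2)
        fun x y hxy => Subtype.ext (Subtype.ext (congrArg (fun v : V => v.1) hxy))
    obtain ⟨S, hS⟩ := Module.Finite.iff_fg.1 this
    refine ⟨S, ?_⟩
    rw [← Algebra.adjoin_span, hS]
  · have : B ≤ (invariantFunctions A H).comap A.val := Algebra.adjoin_le fun f hf => hVP hf
    exact this
  · intro f hf
    exact B.tmul_one_eq_one_tmul_of_forall f fun i₁ i₂ hi => algHom_eq_of_generators hA B hBstab F b
      (fun i => Algebra.subset_adjoin (hSV (Or.inr ⟨i, rfl⟩))) hF1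
      (Algebra.subset_adjoin (hSV (Or.inl rfl))) hb1 hgen i₁ i₂ hi f hf

end Descent

/-! ### Generic statements about B moved to every point by translation -/

section Quotient

open scoped TensorProduct

variable {k : Type u} [Field k] {G : Type v} [Group G] {A : Subalgebra k (G → k)} {H : Subgroup G}

theorem IsAffineAlgebraicGroup.leftTranslate_apply (hA : IsAffineAlgebraicGroup A) (g : G) (f : A)
    (x : G) : (hA.leftTranslate g f).1 x = f.1 (g * x) := rfl

theorem exists_mem_minimalPrimes (R : Type*) [CommRing R] [Nontrivial R] :
    ∃ p : Ideal R, p ∈ minimalPrimes R := by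
  obtain ⟨m, hm⟩ := Ideal.exists_maximal R
  have := hm.isPrime
  obtain ⟨p, hp, -⟩ := Ideal.exists_minimalPrimes_le (bot_le (a := m))
  exact ⟨p, hp⟩

theorem isReduced_subalgebra_subalgebra {X : Type*} {A : Subalgebra k (X → k)}
    (B : Subalgebra k A) : IsReduced B :=
  isReduced_of_injective (A.val.comp B.val)
    (Subtype.val_injective.comp Subtype.val_injective)

/-- Generic descent supplies a denominator that is nonzero at some point x₁; left translation by
x₁x⁻¹ makes it nonzero at x. -/
theorem exists_mul_mem_of_descent (hA : IsAffineAlgebraicGroup A) (B : Subalgebra k A)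
    (hBstab : ∀ g, ∀ f ∈ B, hA.leftTranslate g f ∈ B)
    (hdesc : ∀ f : A, f.1 ∈ invariantFunctions A H → f ⊗ₜ[B] (1 : A) = 1 ⊗ₜ f)
    (f : A) (hf : f.1 ∈ invariantFunctions A H) (x : G) : ∃ c ∈ B, c.1 x ≠ 0 ∧ c * f ∈ B := by
  obtain ⟨E, _, hEP, hfE, hE⟩ := hA.exists_left_stable {f.1} (Set.finite_singleton _)
    (Subalgebra.toSubmodule (invariantFunctions A H))
    (fun f hf => hf.1) (fun f hf g => hA.mul_left_mem_invariantFunctions hf g) (by simpa using hf)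
  have : IsReduced B := isReduced_subalgebra_subalgebra B
  have : Nontrivial A := ⟨0, 1, fun h => zero_ne_one (congrFun (congrArg Subtype.val h) (1 : G))⟩
  obtain ⟨p, hp⟩ := exists_mem_minimalPrimes B
  have := hp.1.1
  let b := Module.finBasis k E
  choose s hsp hs using fun i => exists_smul_mem_range_of_tmul_one_eq hp
    (hdesc ⟨(b i).1, (hEP (b i).2).1⟩ (hEP (b i).2))
  -- A common denominator for the whole left-stable space E is needed, because it gets applied to a
  -- translate of `f`.
  let t : B := ∏ i, s i
  have htp : t ∉ p := p.primeCompl.prod_mem fun i _ => hsp i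
  have ht : ∀ e : A, e.1 ∈ E → t.1 * e ∈ B := by
    intro e he
    have h1 : e = ∑ i, b.repr ⟨e.1, he⟩ i • (⟨(b i).1, (hEP (b i).2).1⟩ : A) := by
      have h2 := congrArg Subtype.val (b.sum_repr ⟨e.1, he⟩)
      simp only [Submodule.coe_sum, Submodule.coe_smul] at h2
      refine Subtype.ext (h2.symm.trans ?_)
      simp
    rw [h1, Finset.mul_sum]
    refine B.sum_mem fun i _ => ?_
    rw [mul_smul_comm]
    refine B.smul_mem ?_ _
    obtain ⟨r, hr⟩ := hs i
    have h3 : t = (∏ j ∈ Finset.univ.erase i, s j) * s i :=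
      (Finset.prod_erase_mul _ _ (Finset.mem_univ i)).symm
    rw [h3]
    change ((∏ j ∈ Finset.univ.erase i, s j : B).1 * (s i).1) * _ ∈ B
    rw [mul_assoc]
    refine B.mul_mem (Subtype.prop _) ?_
    have h4 : (s i).1 * (⟨(b i).1, (hEP (b i).2).1⟩ : A) = r.1 := hr.symm
    rw [h4]
    exact r.2
  obtain ⟨x₁, hx₁⟩ : ∃ x₁, t.1.1 x₁ ≠ 0 := by
    by_contra! h
    have h0 : t = 0 := Subtype.ext (Subtype.ext (funext h))
    exact htp (h0 ▸ p.zero_mem)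
  let g := x₁ * x⁻¹
  refine ⟨hA.leftTranslate g t.1, hBstab g _ t.2, ?_, ?_⟩
  · rw [hA.leftTranslate_apply]
    simpa [g] using hx₁
  · have h1 : hA.leftTranslate g t.1 * f =
        hA.leftTranslate g (t.1 * hA.leftTranslate g⁻¹ f) := by
      rw [map_mul]
      congr 1
      refine Subtype.ext (funext fun y => ?_)
      simp [hA.leftTranslate_apply]
    rw [h1]
    exact hBstab g _ (ht _ (hE _ (hfE rfl) g⁻¹))

theorem Subalgebra.finitePresentation_of_fg {k S : Type*} [Field k] [CommRing S] [Algebra k S]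
    [Algebra.FiniteType k S] (B : Subalgebra k S) (hB : B.FG) : Algebra.FinitePresentation B S := by
  have : Algebra.FiniteType k B := B.fg_iff_finiteType.mp hB
  have : IsNoetherianRing B := Algebra.FiniteType.isNoetherianRing k B
  have : Algebra.FiniteType B S := Algebra.FiniteType.of_restrictScalars_finiteType k B S
  exact Algebra.FinitePresentation.of_finiteType.1 this

/-- Homomorphisms to `k` from a subalgebra extend generically. -/
theorem Subalgebra.exists_algHom_extension {k S : Type*} [Field k] [IsAlgClosed k] [CommRing S]
    [Algebra k S] [Algebra.FiniteType k S] [Nontrivial S] (B : Subalgebra k S) (hB : B.FG)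
    [IsReduced B] :
    ∃ s : B, s ≠ 0 ∧ ∀ y : B →ₐ[k] k, y s ≠ 0 → ∃ ψ : S →ₐ[k] k, ∀ f : B, ψ f = y f := by
  have : Algebra.FinitePresentation B S := B.finitePresentation_of_fg hB
  obtain ⟨p, hp⟩ := exists_mem_minimalPrimes B
  obtain ⟨s, hsp, hs⟩ := exists_basicOpen_subset_range_comap (S := S) hp Subtype.val_injective
  refine ⟨s, fun h => hsp (h ▸ p.zero_mem), fun y hy => ?_⟩
  obtain ⟨q, hq⟩ := hs ⟨RingHom.ker y, RingHom.ker_isPrime _⟩ hy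
  have hq' : q.asIdeal.comap (algebraMap B S) = RingHom.ker y := congrArg PrimeSpectrum.asIdeal hq
  -- Any maximal ideal above `q` will do: it contains the kernel of y, which forces its homomorphism
  -- to k to restrict to y.
  obtain ⟨m, hm, hqm⟩ := Ideal.exists_le_maximal q.asIdeal q.2.ne_top
  obtain ⟨ψ, hψ⟩ := exists_algHom_of_isMaximal (k := k) m
  refine ⟨ψ, fun f => ?_⟩
  have h1 : f - algebraMap k B (y f) ∈ q.asIdeal.comap (algebraMap B S) := by
    rw [hq', RingHom.mem_ker, map_sub, AlgHom.commutes]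
    exact sub_self _
  have h2 : ψ (f.1 - algebraMap k S (y f)) = 0 := (hψ _).1 (hqm h1)
  rw [map_sub, AlgHom.commutes] at h2
  exact sub_eq_zero.1 h2

/-- Chevalley gives one nonempty principal open set inside the image of `G`; its translates cover
the image, which is therefore open. -/
theorem exists_eval_of_ne_zero [IsAlgClosed k] (hA : IsAffineAlgebraicGroup A) (B : Subalgebra k A)
    (hB : B.FG) (hBstab : ∀ g, ∀ f ∈ B, hA.leftTranslate g f ∈ B) (x : G) :
    ∃ b : B, b.1.1 x ≠ 0 ∧ ∀ y : B →ₐ[k] k, y b ≠ 0 → ∃ x' : G, ∀ f : B, y f = f.1.1 x' := by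
  have : IsReduced B := isReduced_subalgebra_subalgebra B
  have : Nontrivial A := ⟨0, 1, fun h => zero_ne_one (congrFun (congrArg Subtype.val h) (1 : G))⟩
  have : Algebra.FiniteType k A := A.fg_iff_finiteType.mp hA.fg
  obtain ⟨s, hs0, hs⟩ := B.exists_algHom_extension hB
  have key : ∀ y : B →ₐ[k] k, y s ≠ 0 → ∃ x' : G, ∀ f : B, y f = f.1.1 x' := by
    intro y hy
    obtain ⟨ψ, hψ⟩ := hs y hy
    obtain ⟨x', hx'⟩ := hA.eval_bijective.2 ψ
    exact ⟨x', fun f => (hψ f).symm.trans (DFunLike.congr_fun hx' f.1).symm⟩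
  obtain ⟨x₁, hx₁⟩ : ∃ x₁, s.1.1 x₁ ≠ 0 := by
    by_contra! h
    exact hs0 (Subtype.ext (Subtype.ext (funext h)))
  let L : G → B →ₐ[k] B := fun g =>
    ((hA.leftTranslate g).comp B.val).codRestrict B fun f => hBstab g f.1 f.2
  have hL : ∀ g f z, (L g f).1.1 z = f.1.1 (g * z) := fun _ _ _ => rfl
  let g := x₁ * x⁻¹
  refine ⟨L g s, ?_, fun y hy => ?_⟩
  · rw [hL]
    simpa [g] using hx₁
  · obtain ⟨x', hx'⟩ := key (y.comp (L g)) hy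
    refine ⟨g⁻¹ * x', fun f => ?_⟩
    have h1 : L g (L g⁻¹ f) = f := Subtype.ext (Subtype.ext (funext fun z => by simp [hL]))
    have h2 := hx' (L g⁻¹ f)
    rw [AlgHom.comp_apply, h1, hL] at h2
    exact h2

end Quotient

/-! ### The affine variety of a finitely generated algebra -/

section MaximalSpectrum

/-- The homomorphisms to `k` of a finitely generated algebra are the points of an affine variety. -/
theorem exists_isAffineVariety {k : Type u} [Field k] {R : Type v} [CommRing R] [Algebra k R]
    [Algebra.FiniteType k R] :
    ∃ (Y : Type u) (e : (R →ₐ[k] k) ≃ Y) (Φ : R →ₐ[k] (Y → k)),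
      (∀ r y, Φ r (e y) = y r) ∧ IsAffineVariety Φ.range := by
  obtain ⟨n, π, hπ⟩ := Algebra.FiniteType.iff_quotient_mvPolynomial''.1 ‹Algebra.FiniteType k R›
  have : Small.{u} (R →ₐ[k] k) := by
    refine small_of_injective (β := Fin n → k) (f := fun y i => y (π (MvPolynomial.X i))) ?_
    intro y y' h
    have h1 : y.comp π = y'.comp π := MvPolynomial.algHom_ext fun i => congrFun h i
    ext r
    obtain ⟨q, rfl⟩ := hπ r
    exact DFunLike.congr_fun h1 q
  let e := equivShrink.{u} (R →ₐ[k] k)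
  let Φ : R →ₐ[k] (Shrink.{u} (R →ₐ[k] k) → k) := AlgHom.pi fun y => e.symm y
  have hΦ : ∀ r y, Φ r y = e.symm y r := fun _ _ => rfl
  refine ⟨_, e, Φ, fun r y => by rw [hΦ, e.symm_apply_apply], ?_, ?_, ?_⟩
  · rw [Subalgebra.fg_iff_finiteType]
    exact Algebra.FiniteType.of_surjective Φ.rangeRestrict Φ.rangeRestrict_surjective
  · intro y y' h
    refine e.symm.injective (AlgHom.ext fun r => ?_)
    exact DFunLike.congr_fun h (Φ.rangeRestrict r)
  · intro ψ
    refine ⟨e (ψ.comp Φ.rangeRestrict), AlgHom.ext fun f => ?_⟩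
    obtain ⟨r, rfl⟩ := Φ.rangeRestrict_surjective f
    change Φ r (e (ψ.comp Φ.rangeRestrict)) = _
    rw [hΦ, e.symm_apply_apply]
    rfl

end MaximalSpectrum

/-! ### The homogeneous space as an open subset of the variety of B -/

section HomogeneousSpace

variable {k : Type u} [Field k] {G : Type v} [Group G] {A : Subalgebra k (G → k)} {H : Subgroup G}

theorem isOpen_homogeneousSpace_iff (O : Set (homogeneousSpace A H).carrier) :
    IsOpen O ↔ @IsOpen G (zariskiTopology A) {x | (Quotient.mk (QuotientGroup.leftRel H) x :
      (homogeneousSpace A H).carrier) ∈ O} := Iff.rfl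

theorem mem_regular_homogeneousSpace_iff (U : Opens (homogeneousSpace A H).carrier) (f : U → k) :
    f ∈ (homogeneousSpace A H).regular U ↔
      ∀ x : {x : G | (Quotient.mk (QuotientGroup.leftRel H) x :
          (homogeneousSpace A H).carrier) ∈ U}, ∃ s ∈ A, s x.1 ≠ 0 ∧ ∃ g ∈ A, ∃ d ∈ A,
        ∀ y : {x : G | (Quotient.mk (QuotientGroup.leftRel H) x :
          (homogeneousSpace A H).carrier) ∈ U}, s y.1 ≠ 0 → d y.1 ≠ 0 ∧
          f ⟨Quotient.mk (QuotientGroup.leftRel H) y.1, y.2⟩ = g y.1 / d y.1 :=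
  mem_regular_ofAffine_iff _ _

/-- The coset xH goes to evaluation at x on B. Separation by elements of B gives injectivity and,
with the openness of the image, an open map; local denominators in B match the regular functions. -/
theorem HasEquivariantExtensions.isQuasiAffine [IsAlgClosed k] (hA : IsAffineAlgebraicGroup A)
    (hH : @IsClosed G (zariskiTopology A) (H : Set G)) (hext : HasEquivariantExtensions A H) :
    (homogeneousSpace A H).IsQuasiAffine := by
  obtain ⟨B, hBfg, hBinv, hBstab, hdesc⟩ := hext.exists_subalgebra hA
  have : Algebra.FiniteType k B := B.fg_iff_finiteType.mp hBfg
  obtain ⟨Y, e, Φ, hΦ, hY⟩ := exists_isAffineVariety (k := k) (R := B)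
  let π : G → (homogeneousSpace A H).carrier := fun x => Quotient.mk (QuotientGroup.leftRel H) x
  have hπ : ∀ x y, π x = π y ↔ x⁻¹ * y ∈ H := fun x y =>
    Quotient.eq.trans QuotientGroup.leftRel_apply
  have hπsurj : Function.Surjective π := Quotient.mk_surjective
  have hπmul : ∀ (x : G) (h : H), π (x * h) = π x := fun x h => (hπ _ _).2 (by simp)
  let ev : G → B →ₐ[k] k := fun x =>
    (Pi.evalAlgHom k (fun _ : G => k) x).comp (A.val.comp B.val)
  have hev : ∀ x b, ev x b = b.1.1 x := fun _ _ => rfl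
  let φ₀ : (homogeneousSpace A H).carrier → Y := Quotient.lift (fun x => e (ev x)) (by
    intro (x : G) (y : G) hxy
    have h1 : x⁻¹ * y ∈ H := QuotientGroup.leftRel_apply.1 hxy
    refine congrArg e (AlgHom.ext fun b => ?_)
    have h2 := (hBinv b.1 b.2).2 x ⟨x⁻¹ * y, h1⟩
    rw [hev, hev, ← h2, mul_inv_cancel_left])
  have hφ₀ : ∀ x, φ₀ (π x) = e (ev x) := fun _ => rfl
  have hφ : ∀ b x, Φ b (φ₀ (π x)) = b.1.1 x := fun b x => by rw [hφ₀, hΦ, hev]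
  have hsep : ∀ (U : Set G), @IsOpen G (zariskiTopology A) U →
      (∀ (x : G) (h : H), x * h ∈ U → x ∈ U) → ∀ x ∈ U,
      ∃ c : B, c.1.1 x ≠ 0 ∧ ∀ z, z ∉ U → c.1.1 z = 0 := by
    intro U hU hUH x hx
    obtain ⟨g, hg, hg0, hgx⟩ := hext.exists_invariant hA U hU hUH x hx
    obtain ⟨c, hc, hcx, hcg⟩ := exists_mul_mem_of_descent hA B hBstab hdesc ⟨g, hg.1⟩ hg x
    exact ⟨⟨_, hcg⟩, mul_ne_zero hcx hgx, fun z hz => mul_eq_zero_of_right _ (hg0 z hz)⟩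
  have hcont : @Continuous _ _ _ (zariskiTopology Φ.range) φ₀ := by
    refine continuous_generateFrom_iff.2 ?_
    rintro _ ⟨_, ⟨b, rfl⟩, rfl⟩
    rw [isOpen_homogeneousSpace_iff]
    have h1 : {x : G | (Quotient.mk (QuotientGroup.leftRel H) x : (homogeneousSpace A H).carrier) ∈
        φ₀ ⁻¹' {y | Φ b y ≠ 0}} = {x | b.1.1 x ≠ 0} :=
      Set.ext fun x => not_congr (by rw [← hφ b x])
    change @IsOpen G (zariskiTopology A) {x : G | (Quotient.mk (QuotientGroup.leftRel H) x :
      (homogeneousSpace A H).carrier) ∈ φ₀ ⁻¹' {y | Φ b y ≠ 0}}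
    rw [h1]
    exact isOpen_zariskiTopology_ne_zero b.1.2
  have hinj : Function.Injective φ₀ := by
    intro q q' hqq'
    obtain ⟨x, rfl⟩ := hπsurj q
    obtain ⟨x', rfl⟩ := hπsurj q'
    by_contra hne
    -- Closedness of `H` enters here: the complement of the coset x'H is open, so an element of B
    -- separates x from it.
    obtain ⟨c, hcx, hc0⟩ := hsep {z | x'⁻¹ * z ∉ H} (by
        rw [isOpen_zariskiTopology_iff]
        intro z hz
        obtain ⟨f, hf, hfz, hfH⟩ := isOpen_zariskiTopology_iff.1 hH.isOpen_compl (x'⁻¹ * z) hz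
        exact ⟨_, hA.mul_left_mem hf x'⁻¹, hfz, fun y hy => hfH _ hy⟩)
      (fun z h hzh hz => hzh (by rw [← mul_assoc]; exact H.mul_mem hz h.2)) x
      (fun h => hne ((hπ _ _).2 h).symm)
    have h1 := hφ c x
    rw [hqq', hφ] at h1
    exact hcx (h1.symm.trans (hc0 x' (by simp)))
  have hopen : ∀ O : Set (homogeneousSpace A H).carrier, IsOpen O →
      @IsOpen Y (zariskiTopology Φ.range) (φ₀ '' O) := by
    intro O hO
    rw [isOpen_zariskiTopology_iff]
    rintro _ ⟨q, hq, rfl⟩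
    obtain ⟨x, rfl⟩ := hπsurj q
    obtain ⟨c, hcx, hc0⟩ := hsep {z | π z ∈ O} hO (fun z h hz => by
      change π z ∈ O
      rw [← hπmul z h]
      exact hz) x hq
    obtain ⟨b, hbx, hb⟩ := exists_eval_of_ne_zero hA B hBfg hBstab x
    refine ⟨Φ (b * c), ⟨_, rfl⟩, ?_, fun y hy => ?_⟩
    · rw [hφ]
      exact mul_ne_zero hbx hcx
    · obtain ⟨ψ, rfl⟩ := e.surjective y
      rw [hΦ, map_mul] at hy
      obtain ⟨x', hx'⟩ := hb ψ (left_ne_zero_of_mul hy)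
      refine ⟨π x', ?_, ?_⟩
      · by_contra hx'O
        refine right_ne_zero_of_mul hy ?_
        rw [hx']
        exact hc0 x' hx'O
      · rw [hφ₀]
        exact congrArg e (AlgHom.ext fun f => (hx' f).symm)
  let φ : C((homogeneousSpace A H).carrier, (SpaceWithFunctions.ofAffine Φ.range).carrier) :=
    ⟨φ₀, hcont⟩
  refine ⟨Y, Φ.range, hY, φ, .of_continuous_injective_isOpenMap hcont hinj hopen, ?_⟩
  intro V hV f
  rw [mem_regular_ofAffine_iff, mem_regular_homogeneousSpace_iff]
  constructor
  · rintro hf ⟨x, hx⟩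
    obtain ⟨_, ⟨s, rfl⟩, hsx, _, ⟨g, rfl⟩, _, ⟨d, rfl⟩, h⟩ := hf ⟨φ₀ (π x), hx⟩
    refine ⟨s.1.1, s.1.2, ?_, g.1.1, g.1.2, d.1.1, d.1.2, ?_⟩
    · rw [← hφ]; exact hsx
    · rintro ⟨y, hy⟩ hsy
      have h1 := h ⟨φ₀ (π y), hy⟩ (by
        change Φ s (φ₀ (π y)) ≠ 0
        rw [hφ]; exact hsy)
      change Φ d (φ₀ (π y)) ≠ 0 ∧ _ = Φ g (φ₀ (π y)) / Φ d (φ₀ (π y)) at h1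
      rw [hφ, hφ] at h1
      exact h1
  · rintro hf ⟨y, hy⟩
    obtain ⟨q, rfl⟩ := hV hy
    obtain ⟨x, rfl⟩ := hπsurj q
    obtain ⟨_, ⟨c, rfl⟩, hcx, hcV⟩ := isOpen_zariskiTopology_iff.1 V.2 _ hy
    have hcU : ∀ z, c.1.1 z ≠ 0 → φ₀ (π z) ∈ V := fun z hz => hcV _ (by
      change Φ c (φ₀ (π z)) ≠ 0
      rwa [hφ])
    obtain ⟨n, g, hg, hcg⟩ := hA.exists_pow_mul_eq {z | φ₀ (π z) ∈ V} (fun z => f ⟨φ₀ (π z.1), z.2⟩)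
      hf c.1.1 c.1.2 hcU
    have hcinv := hBinv c.1 c.2
    -- The function `g` is known to be invariant only where c ≠ 0; the extra factor c kills it
    -- elsewhere. It also accounts for the exponent n + 1 below.
    have hcginv : c.1.1 * g ∈ invariantFunctions A H := by
      refine ⟨A.mul_mem c.1.2 hg, fun z h => ?_⟩
      rw [Pi.mul_apply, Pi.mul_apply, hcinv.2]
      by_cases hz : c.1.1 z = 0
      · simp [hz]
      · have hz' : c.1.1 (z * h) ≠ 0 := by rwa [hcinv.2]
        rw [← hcg _ hz, ← hcg _ hz', hcinv.2]
        simp only [hπmul]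
    obtain ⟨b, hbB, hbx, hβ⟩ := exists_mul_mem_of_descent hA B hBstab hdesc ⟨_, hcginv.1⟩ hcginv x
    let b' : B := ⟨b, hbB⟩
    let β : B := ⟨_, hβ⟩
    change Φ c (φ₀ (π x)) ≠ 0 at hcx
    rw [hφ] at hcx
    refine ⟨Φ (b' * c), ⟨_, rfl⟩, ?_, Φ β, ⟨_, rfl⟩, Φ (b' * c ^ (n + 1)), ⟨_, rfl⟩, ?_⟩
    · change Φ (b' * c) (φ₀ (π x)) ≠ 0
      rw [hφ]
      exact mul_ne_zero hbx hcx
    · rintro ⟨y, hy⟩ hsy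
      obtain ⟨q, rfl⟩ := hV hy
      obtain ⟨z, rfl⟩ := hπsurj q
      change Φ (b' * c) (φ₀ (π z)) ≠ 0 at hsy
      rw [hφ] at hsy
      have hbz : b.1 z ≠ 0 := left_ne_zero_of_mul hsy
      have hcz : c.1.1 z ≠ 0 := right_ne_zero_of_mul hsy
      change Φ (b' * c ^ (n + 1)) (φ₀ (π z)) ≠ 0 ∧
        f ⟨φ₀ (π z), hy⟩ = Φ β (φ₀ (π z)) / Φ (b' * c ^ (n + 1)) (φ₀ (π z))
      rw [hφ, hφ]
      change b.1 z * c.1.1 z ^ (n + 1) ≠ 0 ∧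
        f ⟨φ₀ (π z), hy⟩ = b.1 z * (c.1.1 z * g z) / (b.1 z * c.1.1 z ^ (n + 1))
      refine ⟨mul_ne_zero hbz (pow_ne_zero _ hcz), ?_⟩
      rw [← hcg z hcz]
      field_simp
      ring

end HomogeneousSpace

theorem theorem3p1 {k : Type u} [Field k] [IsAlgClosed k] {G : Type v} [Group G]
    (A : Subalgebra k (G → k)) (hA : IsAffineAlgebraicGroup A)
    (H : Subgroup G) (hH : @IsClosed G (zariskiTopology A) (H : Set G)) :
    IsObservable A H ↔ (homogeneousSpace A H).IsQuasiAffine :=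
  ⟨fun h => h.hasEquivariantExtensions.isQuasiAffine hA hH,
    fun h => (hasEquivariantExtensions_of_isQuasiAffine hA h).isObservable hA⟩
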